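/- Let $A$ be a commutative ring which is connected (if $e(1-e)=0$ in $A$, then $e=0$ or $e=1$) and such that $\mathrm{Pic}(A)=0$, and let $n\ge 0$. Let $T(A)$ be the ring of Laurent polynomials $\sum_p u(p)X^p$ over $A$ in $X_0,\dots,X_n$ all of whose monomials $X^p=X_0^{p_0}\cdots X_n^{p_n}$ $(p\in\mathbb Z^{n+1})$ have total degree $\sum_l p_l=0$. Let $T_i(A)$, $T_{ij}(A)$ and $T_{ijk}(A)$ be the subrings of those elements which contain only monomials $X^p$ with $p_l\ge 0$ for all $l\ne i$, for all $l\neq i,j$, and for all $l\ne i,j,k$, respectively. For each $i\in\{0,\dots,n\}$ let $M_i$ be a (finitely generated) projective module of rank $1$ over $T_i(A)$, and for all $i,j\in\{0,\dots,n\}$ let $$t_{ij}: M_i\otimes_{T_i(A)}T_{ij}(A)\;\xrightarrow{\ \sim\ }\;M_j\otimes_{T_j(A)}T_{ij}(A)$$ be isomorphisms of $T_{ij}(A)$-modules such that $t_{ii}=\mathrm{id}$ for all $i$, and such that $t_{ik}=t_{jk}\circ t_{ij}$ for all $i,j,k$ after base change to $T_{ijk}(A)$. Then there are an integer $d$, invertible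 elements $s_i\in T_i(A)^\times$ and isomorphisms of $T_i(A)$-modules $\psi_i:M_i\simeq T_i(A)$ (for $i=0,\dots,n$) such that, for all $i,j$ and all $x\in M_i\otimes_{T_i(A)} T_{ij}(A)$, $$\psi_j(t_{ij}\,x)=\psi_i(x)\,(X_j/X_i)^d\,s_j/s_i \quad\text{in } T_{ij}(A),$$ where $\psi_i$ and $\psi_j$ also denote the base changes of these isomorphisms to $T_{ij}(A)$. -/

import Mathlib

open scoped TensorProduct

namespace ProjCover

universe u v

/-- The group of exponents `p = (p_0, …, p_n)`, `p_i ∈ ℤ`, with `p_0 + ⋯ + p_n = 0`. -/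
def degZero (n : ℕ) : AddSubgroup (Fin (n + 1) → ℤ) where
  carrier := {p | ∑ l, p l = 0}
  zero_mem' := by simp
  add_mem' := by
    intro p q hp hq
    simp only [Set.mem_ofPred_eq] at hp hq ⊢
    simp [Finset.sum_add_distrib, hp, hq]
  neg_mem' := by
    intro p hp
    simp only [Set.mem_ofPred_eq] at hp ⊢
    simp [hp]

/-- The ring `T(A)` of Laurent polynomials `∑ u(p) X^p`, with coefficients in `A`, all of whose
monomials `X^p = X_0^{p_0} ⋯ X_n^{p_n}` have total degree `0`. -/
abbrev T (A : Type u) [CommRing A] (n : ℕ) : Type u := AddMonoidAlgebra A (degZero n)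

/-- The exponents `p` of total degree `0` with `p_l ≥ 0` for all `l ∉ S`. -/
def expts {n : ℕ} (S : Set (Fin (n + 1))) : AddSubmonoid (degZero n) where
  carrier := {p | ∀ l, l ∉ S → 0 ≤ p.1 l}
  zero_mem' := fun _ _ => le_refl _
  add_mem' := fun hp hq l hl => add_nonneg (hp l hl) (hq l hl)

/-- The subring `T_S(A)` of `T(A)` of the elements which contain only monomials `X^p` with
`p_l ≥ 0` for all `l ∉ S`. -/
noncomputable def TS (A : Type u) [CommRing A] {n : ℕ} (S : Set (Fin (n + 1))) : Subalgebra A (T A n) where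
  carrier := {u | ∀ p ∈ u.coeff.support, p ∈ expts S}
  mul_mem' := by
    classical
    intro u v hu hv p hp
    have h := AddMonoidAlgebra.support_coeff_mul_subset u v hp
    obtain ⟨q, hq, r, hr, rfl⟩ := Finset.mem_add.1 h
    exact (expts S).add_mem (hu q hq) (hv r hr)
  add_mem' := by
    classical
    intro u v hu hv p hp
    have h := Finsupp.support_add hp
    rcases Finset.mem_union.1 h with h | h
    · exact hu p h
    · exact hv p h
  algebraMap_mem' := by
    classical
    intro a p hp
    have h : p ∈ (Finsupp.single (0 : degZero n) a).support := hp
    have h0 := Finset.mem_singleton.1 (Finsupp.support_single_subset h)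
    rw [h0]
    exact (expts S).zero_mem

theorem TS_mono (A : Type u) [CommRing A] {n : ℕ} {S S' : Set (Fin (n + 1))} (h : S ⊆ S') :
    TS A S ≤ TS A S' :=
  fun _ hu p hp l hl => hu p hp l (fun hS => hl (h hS))

/-- If `S ⊆ S'`, then `T_{S'}(A)` is an algebra over its subring `T_S(A)`, by inclusion. -/
noncomputable instance instAlgebra (A : Type u) [CommRing A] {n : ℕ} (S S' : Set (Fin (n + 1)))
    [h : Fact (S ⊆ S')] : Algebra (TS A S) (TS A S') :=
  (Subalgebra.inclusion (TS_mono A h.out)).toRingHom.toAlgebra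

instance instTower (A : Type u) [CommRing A] {n : ℕ} (S S' S'' : Set (Fin (n + 1)))
    [Fact (S ⊆ S')] [Fact (S' ⊆ S'')] [Fact (S ⊆ S'')] :
    IsScalarTower (TS A S) (TS A S') (TS A S'') :=
  IsScalarTower.of_algebraMap_eq fun _ => rfl

section Facts

variable {n : ℕ} (i j k : Fin (n + 1))

instance fact_i_ij : Fact (({i} : Set (Fin (n + 1))) ⊆ {i, j}) := ⟨by simp⟩
instance fact_j_ij : Fact (({j} : Set (Fin (n + 1))) ⊆ {i, j}) := ⟨by simp⟩
instance fact_i_ijk : Fact (({i} : Set (Fin (n + 1))) ⊆ {i, j, k}) := ⟨by simp⟩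
instance fact_j_ijk : Fact (({j} : Set (Fin (n + 1))) ⊆ {i, j, k}) := ⟨by simp⟩
instance fact_k_ijk : Fact (({k} : Set (Fin (n + 1))) ⊆ {i, j, k}) := ⟨by simp⟩
instance fact_ij_ijk : Fact (({i, j} : Set (Fin (n + 1))) ⊆ {i, j, k}) :=
  ⟨by simp [Set.insert_subset_iff]⟩
instance fact_jk_ijk : Fact (({j, k} : Set (Fin (n + 1))) ⊆ {i, j, k}) :=
  ⟨by simp⟩
instance fact_ik_ijk : Fact (({i, k} : Set (Fin (n + 1))) ⊆ {i, j, k}) :=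
  ⟨by simp [Set.insert_subset_iff]⟩

end Facts

/-- `T_i(A)`, the coordinate ring of the chart `X_i ≠ 0`. -/
noncomputable abbrev T₁ (A : Type u) [CommRing A] {n : ℕ} (i : Fin (n + 1)) : Subalgebra A (T A n) :=
  TS A {i}

/-- `T_{ij}(A)`, the coordinate ring of the overlap of the charts `i` and `j`. -/
noncomputable abbrev T₂ (A : Type u) [CommRing A] {n : ℕ} (i j : Fin (n + 1)) : Subalgebra A (T A n) :=
  TS A {i, j}

/-- `T_{ijk}(A)`, the coordinate ring of the overlap of the charts `i`, `j` and `k`. -/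
noncomputable abbrev T₃ (A : Type u) [CommRing A] {n : ℕ} (i j k : Fin (n + 1)) : Subalgebra A (T A n) :=
  TS A {i, j, k}

/-- The exponent of `X_j / X_i`. -/
def ratioExp {n : ℕ} (i j : Fin (n + 1)) : degZero n :=
  ⟨Pi.single j 1 - Pi.single i 1, by
    change ∑ l, (Pi.single j (1 : ℤ) - Pi.single i (1 : ℤ) : Fin (n + 1) → ℤ) l = 0
    simp [Finset.sum_sub_distrib]⟩

theorem ratioExp_add {n : ℕ} (i j : Fin (n + 1)) : ratioExp i j + ratioExp j i = 0 := by
  apply Subtype.ext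
  simp [ratioExp]

theorem single_ratio_mem (A : Type u) [CommRing A] {n : ℕ} (i j a b : Fin (n + 1))
    (ha : a = i ∨ a = j) :
    (AddMonoidAlgebra.single (ratioExp a b) 1 : T A n) ∈ TS A {i, j} := by
  classical
  intro p hp l hl
  have h : p ∈ (Finsupp.single (ratioExp a b) (1 : A)).support := hp
  have h0 := Finset.mem_singleton.1 (Finsupp.support_single_subset h)
  rw [h0]
  have hla : l ≠ a := by
    rintro rfl
    exact hl (by simpa using ha)
  simp only [ratioExp, Pi.sub_apply, Pi.single_apply, if_neg hla, sub_zero]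
  split_ifs <;> simp

/-- The monomial `X_j / X_i`, as an invertible element of `T_{ij}(A)` (with inverse `X_i / X_j`). -/
noncomputable def ratio (A : Type u) [CommRing A] {n : ℕ} (i j : Fin (n + 1)) : (T₂ A i j)ˣ where
  val := ⟨AddMonoidAlgebra.single (ratioExp i j) 1, single_ratio_mem A i j i j (Or.inl rfl)⟩
  inv := ⟨AddMonoidAlgebra.single (ratioExp j i) 1, single_ratio_mem A i j j i (Or.inr rfl)⟩
  val_inv := by
    apply Subtype.ext
    change (AddMonoidAlgebra.single (ratioExp i j) 1 * AddMonoidAlgebra.single (ratioExp j i) 1 :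
      T A n) = 1
    rw [AddMonoidAlgebra.single_mul_single, ratioExp_add, mul_one]
    rfl
  inv_val := by
    apply Subtype.ext
    change (AddMonoidAlgebra.single (ratioExp j i) 1 * AddMonoidAlgebra.single (ratioExp i j) 1 :
      T A n) = 1
    rw [AddMonoidAlgebra.single_mul_single, ratioExp_add, mul_one]
    rfl

/-- The base change along `S → U` of an isomorphism `S ⊗[R] M ≃ S ⊗[R'] N`, read as an isomorphism
`U ⊗[R] M ≃ U ⊗[R'] N` through the canonical identifications `U ⊗[S] (S ⊗[R] M) = U ⊗[R] M`. -/
noncomputable def restrictOverlap {R R' S : Type*} (U : Type*) {M N : Type*}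
    [CommRing R] [CommRing R'] [CommRing S] [CommRing U]
    [Algebra R S] [Algebra R' S] [Algebra S U] [Algebra R U] [Algebra R' U]
    [IsScalarTower R S U] [IsScalarTower R' S U]
    [AddCommGroup M] [Module R M] [AddCommGroup N] [Module R' N]
    (e : S ⊗[R] M ≃ₗ[S] S ⊗[R'] N) : U ⊗[R] M ≃ₗ[U] U ⊗[R'] N :=
  (TensorProduct.AlgebraTensorModule.cancelBaseChange R S U U M).symm ≪≫ₗ
    TensorProduct.AlgebraTensorModule.congr (LinearEquiv.refl U U) e ≪≫ₗ
    TensorProduct.AlgebraTensorModule.cancelBaseChange R' S U U N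

/-- The base change `S ⊗[R] M ≃ S ⊗[R] R = S` along `R → S` of a trivialisation `M ≃ R`. -/
noncomputable def baseChangeTriv {R : Type*} (S : Type*) {M : Type*} [CommRing R] [CommRing S]
    [Algebra R S] [AddCommGroup M] [Module R M] (ψ : M ≃ₗ[R] R) : S ⊗[R] M ≃ₗ[S] S :=
  TensorProduct.AlgebraTensorModule.congr (LinearEquiv.refl S S) ψ ≪≫ₗ
    TensorProduct.AlgebraTensorModule.rid R S S

/-- A projective module of rank `1`: finitely generated, projective, and of rank `1` at every
prime. -/
structure IsProjRankOne (R : Type*) (M : Type*) [CommRing R] [AddCommGroup M] [Module R M] :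
    Prop where
  finite : Module.Finite R M
  projective : Module.Projective R M
  rank_eq_one : ∀ p : PrimeSpectrum R, Module.rankAtStalk M p = 1

end ProjCover

/-!
A rank one projective module on projective space over a connected ring `A` with trivial Picard
group is given by modules on the charts and a cocycle of isomorphisms. The proof first makes the
modules on the charts free, and then analyses the resulting cocycle of units. Both steps reduce to
invertible sheaves on a projective line over a connected ring `B`.

*Invertible sheaves on a projective line* (`LaurentLine.Glued.exists_trivialization`). Such a sheaf
`L` is given by lattices over `B[T]` and `B[T⁻¹]` in an invertible module over `B[T;T⁻¹]`. Over the
residue field of a maximal ideal of `B` both lattices are free and the transition function is a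
unit of a Laurent polynomial ring over a field, hence a monomial, so that `L` has the form `𝒪(-d)`
on this fibre. The first cohomology of the twist `L(d)` is finitely generated and vanishes on the
fibre; Nakayama's lemma then lifts the generating section of the fibre to a global section of
`L(d)`, up to a change in `𝔪 E`, and similarly for the dual (`exists_section_lift`). So the ideals
`degIdeal d` generated by the products of sections of `L(d)` and of its dual have sum `B`, and they
are mutually orthogonal because `𝒪(d)` has no nonzero sections for `d < 0`. As `B` is connected,
one of them is `B`, which gives sections `s a`, `s' a` with `∑ s a * s' a = 1`. If `L` is trivial
at `T = 0`, restriction to `T = 0` turns them into scalars, and suitable linear combinations become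
a single section and its inverse.

*Freeness on the charts* (`ProjCover.nonempty_linearEquiv_of_glued`). For `i ≠ j` the overlap ring
`T_{ij}(A)` is `B[T;T⁻¹]`, where `T = X_j / X_i` and `B` is a polynomial ring over `A`, which is
connected again. Here `T_j(A) = B[T⁻¹]`, and `T_i(A)` is contained in `B[T]`: geometrically, the
chart `i` is blown up in the point where all other coordinates vanish. Restricted to `T = 0` the
module `M_i` comes from this point, that is from a projective module of rank one over `A`, which is
free since `Pic(A) = 0`. So the above applies, and the restriction of the trivialised sheaf to
`B[T⁻¹]` is `M_j`.

*Units* (`ProjCover.cocycle_eq`). The same theorem for the free module of rank one factors each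
unit of `T_{ij}(A)` as `(X_j / X_i) ^ d * a * b`, with `a` a unit of `T_j(A)` and `b` a unit of
`B[T]` that is `1` at `T = 0` (`exists_unit_factorization`). On triple overlaps a comparison of
leading terms in `X_i` shows that `d` and `b` do not depend on `j` (`factorization_unique`). Hence
`b` lies in `B[T]` and in all `T_{ij}(A)`, so in `T_i(A)`, and the cocycle is `(X_j / X_i) ^ d` up
to a coboundary.
-/

namespace LaurentLine

open LaurentPolynomial
open scoped Polynomial
open Polynomial (toLaurent toLaurentAlg)

/-! ### Nonnegative and nonpositive parts of a Laurent polynomial ring -/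

/-- The subring `B[T]` of `B[T;T⁻¹]`. -/
noncomputable def nonneg (B : Type*) [CommRing B] : Subalgebra B B[T;T⁻¹] :=
  (toLaurentAlg (R := B)).range

/-- The subring `B[T⁻¹]` of `B[T;T⁻¹]`. -/
noncomputable def nonpos (B : Type*) [CommRing B] : Subalgebra B B[T;T⁻¹] :=
  ((invert (R := B)).toAlgHom.comp toLaurentAlg).range

section Laurent

variable {B : Type*} [CommRing B]

theorem mem_nonneg_iff {f : B[T;T⁻¹]} : f ∈ nonneg B ↔ ∀ k < 0, f.coeff k = 0 := by
  constructor
  · rintro ⟨g, rfl⟩ k hk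
    change (toLaurent g).coeff k = 0
    rw [← Finsupp.notMem_support_iff, LaurentPolynomial.support_coeff_toLaurent]
    simp only [Finset.mem_map, not_exists, not_and]
    rintro m - rfl
    exact absurd hk (by simp)
  · intro h
    have : f = f.coeff.sum fun k b => (C b * T k : B[T;T⁻¹]) := by
      ext k
      simp [Finsupp.sum, ← single_eq_C_mul_T, AddMonoidAlgebra.coeff_sum,
        Finsupp.single_apply]
    rw [this]
    refine Subalgebra.sum_mem _ fun k hk => ?_
    have hk0 : 0 ≤ k := by
      by_contra hlt
      exact (Finsupp.mem_support_iff.1 hk) (h k (by omega))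
    obtain ⟨m, rfl⟩ := Int.eq_ofNat_of_zero_le hk0
    exact ⟨Polynomial.C (f.coeff (m : ℤ)) * Polynomial.X ^ m, by
      simp⟩

theorem mem_nonpos_iff_invert {f : B[T;T⁻¹]} : f ∈ nonpos B ↔ invert f ∈ nonneg B := by
  constructor
  · rintro ⟨g, rfl⟩
    exact ⟨g, (involutive_invert _).symm⟩
  · rintro ⟨g, hg⟩
    refine ⟨g, ?_⟩
    change invert (toLaurentAlg g) = f
    exact (congrArg invert hg).trans (involutive_invert f)

theorem mem_nonpos_iff {f : B[T;T⁻¹]} : f ∈ nonpos B ↔ ∀ k > 0, f.coeff k = 0 := by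
  rw [mem_nonpos_iff_invert, mem_nonneg_iff]
  constructor
  · intro h k hk
    simpa using h (-k) (by omega)
  · intro h k hk
    simpa using h (-k) (by omega)

theorem coeff_mul_T (f : B[T;T⁻¹]) (d k : ℤ) : (f * T d).coeff k = f.coeff (k - d) := by
  have := AddMonoidAlgebra.coeff_mul_single_eq_coeff_mul (x := f) (r := (1 : B)) (m := d)
    (m₁ := k) (k - d) (by intros; omega)
  rwa [mul_one] at this

theorem T_mem_nonneg {k : ℤ} (hk : 0 ≤ k) : (T k : B[T;T⁻¹]) ∈ nonneg B :=
  mem_nonneg_iff.2 fun l hl => by rw [T_apply, if_neg (by omega)]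

theorem T_mem_nonpos {k : ℤ} (hk : k ≤ 0) : (T k : B[T;T⁻¹]) ∈ nonpos B :=
  mem_nonpos_iff.2 fun l hl => by rw [T_apply, if_neg (by omega)]

theorem C_mem_nonneg (b : B) : (C b : B[T;T⁻¹]) ∈ nonneg B := (nonneg B).algebraMap_mem b

theorem C_mem_nonpos (b : B) : (C b : B[T;T⁻¹]) ∈ nonpos B := (nonpos B).algebraMap_mem b

theorem exists_nonneg_add_nonpos (f : B[T;T⁻¹]) : ∃ g ∈ nonneg B, ∃ h ∈ nonpos B, f = g + h := by
  induction f using LaurentPolynomial.induction_on' with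
  | add p q hp hq =>
    obtain ⟨g, hg, h, hh, rfl⟩ := hp
    obtain ⟨g', hg', h', hh', rfl⟩ := hq
    exact ⟨g + g', add_mem hg hg', h + h', add_mem hh hh', by ring⟩
  | C_mul_T n a =>
    rcases le_total 0 n with hn | hn
    · exact ⟨_, mul_mem (C_mem_nonneg a) (T_mem_nonneg hn), 0, zero_mem _, by simp⟩
    · exact ⟨0, zero_mem _, _, mul_mem (C_mem_nonpos a) (T_mem_nonpos hn), by simp⟩

theorem eq_C_of_mem {f : B[T;T⁻¹]} (h₀ : f ∈ nonneg B) (h₁ : f ∈ nonpos B) :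
    f = C (f.coeff 0) := by
  ext k
  rw [C_apply]
  rcases lt_trichotomy k 0 with hk | hk | hk
  · rw [mem_nonneg_iff.1 h₀ k hk, if_neg (by omega)]
  · simp [hk]
  · rw [mem_nonpos_iff.1 h₁ k hk, if_neg (by omega)]

/-- The line bundle `𝒪(-d)` on the projective line has no sections if `d > 0`. -/
theorem eq_zero_of_mem {f : B[T;T⁻¹]} {d : ℤ} (hd : 0 < d) (h₀ : f ∈ nonneg B)
    (h₁ : T d * f ∈ nonpos B) : f = 0 := by
  ext k
  rcases lt_or_ge k 0 with hk | hk
  · exact mem_nonneg_iff.1 h₀ k hk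
  · have := mem_nonpos_iff.1 h₁ (k + d) (by omega)
    rwa [T_mul, coeff_mul_T, add_sub_cancel_right] at this

theorem exists_T_mul_mem_nonpos (f : B[T;T⁻¹]) : ∃ K : ℕ, ∀ k ≤ -(K : ℤ), T k * f ∈ nonpos B := by
  induction f using LaurentPolynomial.induction_on' with
  | add p q hp hq =>
    obtain ⟨K, hK⟩ := hp
    obtain ⟨K', hK'⟩ := hq
    refine ⟨K + K', fun k hk => ?_⟩
    rw [mul_add]
    exact add_mem (hK k (by push_cast at hk; omega)) (hK' k (by push_cast at hk; omega))
  | C_mul_T n a =>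
    refine ⟨n.natAbs, fun k hk => ?_⟩
    rw [mul_left_comm, ← T_add]
    exact mul_mem (C_mem_nonpos a) (T_mem_nonpos (by omega))

/-- Evaluation at `T = 0`, on products of elements of `B[T]`. -/
theorem coeff_zero_mul {f g : B[T;T⁻¹]} (hf : f ∈ nonneg B) (hg : g ∈ nonneg B) :
    (f * g).coeff 0 = f.coeff 0 * g.coeff 0 := by
  have key : ∀ p : B[X], (toLaurent p).coeff 0 = p.coeff 0 := fun p => by
    rw [LaurentPolynomial.coeff_toLaurent]
    exact Finsupp.mapDomain_apply Nat.castEmbedding.injective _ 0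
  obtain ⟨p, rfl⟩ := hf
  obtain ⟨q, rfl⟩ := hg
  change (toLaurent p * toLaurent q).coeff 0 = (toLaurent p).coeff 0 * (toLaurent q).coeff 0
  rw [← map_mul, key, key, key, Polynomial.mul_coeff_zero]

variable {k : Type*} [CommRing k]

/-- Reduction of the coefficients of Laurent polynomials along `B → k`. -/
noncomputable abbrev red (φ : B →+* k) : B[T;T⁻¹] →+* k[T;T⁻¹] := AddMonoidAlgebra.mapRingHom ℤ φ

theorem red_C (φ : B →+* k) (b : B) : red φ (C b) = C (φ b) :=
  AddMonoidAlgebra.mapRingHom_single ..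

theorem red_T (φ : B →+* k) (d : ℤ) : red φ (T d) = T d :=
  (AddMonoidAlgebra.mapRingHom_single ..).trans (by rw [map_one]; rfl)

theorem red_toLaurent (φ : B →+* k) (p : B[X]) : red φ (toLaurent p) = toLaurent (p.map φ) := by
  induction p using Polynomial.induction_on' with
  | add p q hp hq => simp only [map_add, hp, hq, Polynomial.map_add]
  | monomial n a =>
    rw [← Polynomial.C_mul_X_pow_eq_monomial]
    simp only [map_mul, Polynomial.map_mul, Polynomial.toLaurent_C, Polynomial.map_C, red_C,
      Polynomial.toLaurent_X_pow, Polynomial.map_pow, Polynomial.map_X, red_T]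

theorem red_invert (φ : B →+* k) (f : B[T;T⁻¹]) : red φ (invert f) = invert (red φ f) := by
  ext d
  simp

theorem smul_mem_of_red_eq_zero {E : Type*} [AddCommGroup E] [Module B[T;T⁻¹] E] [Module B E]
    [IsScalarTower B B[T;T⁻¹] E] (φ : B →+* k) {f : B[T;T⁻¹]} (hf : red φ f = 0) (v : E) :
    f • v ∈ RingHom.ker φ • (⊤ : Submodule B E) := by
  have : f = f.coeff.sum fun k b => b • (T k : B[T;T⁻¹]) := by
    ext k
    simp [Finsupp.sum, AddMonoidAlgebra.coeff_sum]
  rw [this, Finsupp.sum, Finset.sum_smul]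
  refine Submodule.sum_mem _ fun d _ => ?_
  rw [smul_assoc]
  refine Submodule.smul_mem_smul ?_ trivial
  have := congrArg (fun g => g.coeff d) hf
  simpa using this

/-- A unit of `k[T;T⁻¹]`, for a field `k`, is a monomial. -/
theorem exists_eq_C_mul_T_of_mul_eq_one {k : Type*} [Field k] {u v : k[T;T⁻¹]} (h : u * v = 1) :
    ∃ (c : k) (d : ℤ), c ≠ 0 ∧ u = C c * T d ∧ v = C c⁻¹ * T (-d) := by
  obtain ⟨n, f, hf⟩ := exists_T_pow u
  obtain ⟨m, g, hg⟩ := exists_T_pow v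
  have hfg : f * g = Polynomial.X ^ (n + m) := by
    apply Polynomial.toLaurent_injective
    rw [map_mul, hf, hg, Polynomial.toLaurent_X_pow, Nat.cast_add, T_add]
    linear_combination (T (n : ℤ) * T (m : ℤ)) * h
  obtain ⟨i, -, hi⟩ := (dvd_prime_pow Polynomial.prime_X (n + m)).1 (Dvd.intro g hfg)
  obtain ⟨w, hw⟩ := hi.symm
  obtain ⟨c, hc, hcw⟩ := Polynomial.isUnit_iff.1 w.isUnit
  have hu : u = C c * T ((i : ℤ) - n) := by
    have h1 : u * T (n : ℤ) = T (i : ℤ) * C c := by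
      rw [← hf, ← hw, map_mul, Polynomial.toLaurent_X_pow, ← hcw, Polynomial.toLaurent_C]
    have h2 : (T (n : ℤ) * T (-n) : k[T;T⁻¹]) = 1 := by rw [← T_add]; simp
    rw [sub_eq_add_neg, T_add]
    linear_combination T (-(n : ℤ)) * h1 - u * h2
  refine ⟨c, _, hc.ne_zero, hu, ?_⟩
  have h3 : u * (C c⁻¹ * T (-((i : ℤ) - n))) = 1 := by
    rw [hu, mul_mul_mul_comm, ← map_mul, mul_inv_cancel₀ hc.ne_zero, ← T_add]
    simp
  linear_combination (C c⁻¹ * T (-((i : ℤ) - n))) * h - v * h3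

/-- A square matrix of rank one and trace `1` over a principal ideal domain is
`u ⬝ v` with `v ⬝ u = 1`, so that its entries represent `1`. -/
theorem exists_sum_mul_eq_one {D ι : Type*} [CommRing D] [IsDomain D] [IsBezout D] [Fintype ι]
    (G : ι → ι → D) (hG : ∀ a b c d, G a b * G c d = G a d * G c b) (htr : ∑ a, G a a = 1) :
    ∃ c u : ι → D, ∑ a, ∑ b, c a * u b * G a b = 1 := by
  classical
  obtain ⟨b, hb⟩ : ∃ b, G b b ≠ 0 := by
    by_contra! h
    simp [h] at htr
  obtain ⟨g, hg⟩ := (IsBezout.isPrincipal_of_FG (Ideal.span (Set.range fun a => G a b))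
    ⟨Finset.univ.image fun a => G a b, by simp⟩).principal
  have hgm : g ∈ Ideal.span (Set.range fun a => G a b) := by
    rw [hg]; exact Submodule.mem_span_singleton_self g
  obtain ⟨c, hc⟩ := (Ideal.mem_span_range_iff_exists_fun).1 hgm
  have hu : ∀ a, ∃ u, G a b = g * u := fun a => by
    have : G a b ∈ Ideal.span {g} := by
      rw [← Ideal.submodule_span_eq, ← hg]; exact Ideal.subset_span ⟨a, rfl⟩
    exact Ideal.mem_span_singleton'.1 this |>.imp fun u hu => by rw [← hu, mul_comm]
  choose u hu using hu
  have hg0 : g ≠ 0 := fun h => hb (by rw [hu, h, zero_mul])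
  have hcu : ∑ a, c a * u a = 1 := by
    apply mul_left_cancel₀ hg0
    rw [Finset.mul_sum, mul_one]
    refine Eq.trans ?_ hc
    exact Finset.sum_congr rfl fun a _ => by linear_combination (-c a) * hu a
  have hGu : ∀ a d e, u a * G d e = u d * G a e := fun a d e => by
    apply mul_left_cancel₀ hg0
    have := hG a b d e
    rw [hu a, hu d] at this
    linear_combination this
  refine ⟨c, u, ?_⟩
  calc ∑ a, ∑ d, c a * u d * G a d = ∑ a, ∑ d, c a * u a * G d d :=
        Finset.sum_congr rfl fun a _ => Finset.sum_congr rfl fun d _ => by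
          linear_combination c a * hGu d a d
    _ = 1 := by simp_rw [← Finset.mul_sum, htr, mul_one, hcu]

end Laurent

/-! ### Invertible sheaves on the projective line -/

/-- An invertible sheaf on the projective line over `B`, with its dual: `E` and `E'` are the
modules of its sections, and of those of its dual, over the overlap `Spec B[T;T⁻¹]` of the two
charts. The chart `Spec B[T]` is recorded by generators `x`, `x'` of the sections over that chart,
on which the pairing takes values in `B[T]` and represents `1` as a trace, and likewise the chart
`Spec B[T⁻¹]` by `y`, `y'`. The two exchange laws say that `E` and `E'` have rank one. -/
structure Glued (B E E' ι κ : Type*) [CommRing B] [AddCommGroup E] [Module B[T;T⁻¹] E]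
    [AddCommGroup E'] [Module B[T;T⁻¹] E'] [Fintype ι] [Fintype κ] where
  /-- The duality pairing on the overlap. -/
  pair : E →ₗ[B[T;T⁻¹]] E' →ₗ[B[T;T⁻¹]] B[T;T⁻¹]
  exchange : ∀ v v' w, pair v v' • w = pair w v' • v
  exchange' : ∀ v v' w', pair v v' • w' = pair v w' • v'
  /-- Generators of the sections over `Spec B[T]`. -/
  x : ι → E
  /-- Generators of the sections of the dual over `Spec B[T]`. -/
  x' : ι → E'
  /-- Generators of the sections over `Spec B[T⁻¹]`. -/
  y : κ → E
  /-- Generators of the sections of the dual over `Spec B[T⁻¹]`. -/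
  y' : κ → E'
  x_mem : ∀ a c, pair (x a) (x' c) ∈ nonneg B
  x_sum : ∑ a, pair (x a) (x' a) = 1
  y_mem : ∀ a c, pair (y a) (y' c) ∈ nonpos B
  y_sum : ∑ a, pair (y a) (y' a) = 1

namespace Glued

variable {B E E' ι κ : Type*} [CommRing B] [AddCommGroup E] [Module B[T;T⁻¹] E]
    [AddCommGroup E'] [Module B[T;T⁻¹] E'] [Fintype ι] [Fintype κ]

/-- The dual sheaf. -/
noncomputable def flip (L : Glued B E E' ι κ) : Glued B E' E ι κ where
  pair := L.pair.flip
  exchange v v' w := L.exchange' v' v w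
  exchange' v v' w' := L.exchange v' v w'
  x := L.x'
  x' := L.x
  y := L.y'
  y' := L.y
  x_mem a c := L.x_mem c a
  x_sum := L.x_sum
  y_mem a c := L.y_mem c a
  y_sum := L.y_sum

variable (L : Glued B E E' ι κ)

theorem pair_mul_pair (v w : E) (v' w' : E') :
    L.pair v v' * L.pair w w' = L.pair v w' * L.pair w v' := by
  have := congrArg (fun z => L.pair z w') (L.exchange v v' w)
  simp only [map_smul, LinearMap.smul_apply, smul_eq_mul] at this
  rw [this, mul_comm]

theorem expand_x (v : E) : v = ∑ a, L.pair v (L.x' a) • L.x a := by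
  calc v = (∑ a, L.pair (L.x a) (L.x' a)) • v := by rw [L.x_sum, one_smul]
    _ = _ := by rw [Finset.sum_smul]; exact Finset.sum_congr rfl fun a _ => L.exchange _ _ _

theorem expand_y (v : E) : v = ∑ a, L.pair v (L.y' a) • L.y a := by
  calc v = (∑ a, L.pair (L.y a) (L.y' a)) • v := by rw [L.y_sum, one_smul]
    _ = _ := by rw [Finset.sum_smul]; exact Finset.sum_congr rfl fun a _ => L.exchange _ _ _

variable [Module B E] [IsScalarTower B B[T;T⁻¹] E]

/-- The sections over the chart `Spec B[T]`. -/
def chart₀ : Submodule B E where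
  carrier := {v | ∀ c, L.pair v (L.x' c) ∈ nonneg B}
  zero_mem' c := by simp
  add_mem' hv hw c := by simpa using add_mem (hv c) (hw c)
  smul_mem' b v hv c := by
    rw [← algebraMap_smul B[T;T⁻¹] b v, map_smul, LinearMap.smul_apply, smul_eq_mul]
    exact mul_mem ((nonneg B).algebraMap_mem b) (hv c)

/-- The sections of the twist by `𝒪(d)` over the chart `Spec B[T⁻¹]`. -/
def chart₁ (d : ℤ) : Submodule B E where
  carrier := {v | ∀ c, T d * L.pair v (L.y' c) ∈ nonpos B}
  zero_mem' c := by simp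
  add_mem' hv hw c := by simpa [mul_add] using add_mem (hv c) (hw c)
  smul_mem' b v hv c := by
    rw [← algebraMap_smul B[T;T⁻¹] b v, map_smul, LinearMap.smul_apply, smul_eq_mul,
      mul_left_comm]
    exact mul_mem ((nonpos B).algebraMap_mem b) (hv c)

variable {L}

theorem smul_mem_chart₀ {r : B[T;T⁻¹]} (hr : r ∈ nonneg B) {v : E} (hv : v ∈ L.chart₀) :
    r • v ∈ L.chart₀ := fun c => by
  rw [map_smul, LinearMap.smul_apply]; exact mul_mem hr (hv c)

theorem smul_mem_chart₁ {d : ℤ} {r : B[T;T⁻¹]} {e : ℤ} (hr : T (d - e) * r ∈ nonpos B) {v : E}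
    (hv : v ∈ L.chart₁ e) : r • v ∈ L.chart₁ d := fun c => by
  have h : (T (d - e) * T e : B[T;T⁻¹]) = T d := by rw [← T_add, sub_add_cancel]
  rw [map_smul, LinearMap.smul_apply, smul_eq_mul, ← h]
  convert mul_mem hr (hv c) using 1
  ring

theorem x_mem_chart₀ (a : ι) : L.x a ∈ L.chart₀ := L.x_mem a

theorem y_mem_chart₁ (a : κ) : L.y a ∈ L.chart₁ 0 := fun c => by
  rw [T_zero, one_mul]; exact L.y_mem a c

variable (L)

/-- The global sections of the twist by `𝒪(d)`. -/
def sections (d : ℤ) : Submodule B E := L.chart₀ ⊓ L.chart₁ d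

variable {L}

section Dual

variable [Module B E'] [IsScalarTower B B[T;T⁻¹] E']

theorem pair_mem_nonneg {v : E} {v' : E'} (hv : v ∈ L.chart₀) (hv' : v' ∈ L.flip.chart₀) :
    L.pair v v' ∈ nonneg B := by
  rw [L.expand_x v, map_sum, LinearMap.sum_apply]
  refine sum_mem fun a _ => ?_
  rw [map_smul, LinearMap.smul_apply]
  exact mul_mem (hv a) (hv' a)

theorem T_mul_pair_mem_nonpos {v : E} {v' : E'} {d e : ℤ} (hv : v ∈ L.chart₁ d)
    (hv' : v' ∈ L.flip.chart₁ e) : T (d + e) * L.pair v v' ∈ nonpos B := by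
  rw [L.expand_y v, map_sum, LinearMap.sum_apply, Finset.mul_sum]
  refine sum_mem fun a _ => ?_
  rw [map_smul, LinearMap.smul_apply, smul_eq_mul, T_add, mul_mul_mul_comm]
  exact mul_mem (hv a) (hv' a)

theorem pair_sections_eq_C {v : E} {v' : E'} {d : ℤ} (hv : v ∈ L.sections d)
    (hv' : v' ∈ L.flip.sections (-d)) : L.pair v v' = C ((L.pair v v').coeff 0) := by
  refine eq_C_of_mem (pair_mem_nonneg hv.1 hv'.1) ?_
  simpa using T_mul_pair_mem_nonpos hv.2 hv'.2

theorem pair_sections_eq_zero {v : E} {v' : E'} {d e : ℤ} (hde : e < d) (hv : v ∈ L.sections d)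
    (hv' : v' ∈ L.flip.sections (-e)) : L.pair v v' = 0 :=
  eq_zero_of_mem (d := d - e) (by omega) (pair_mem_nonneg hv.1 hv'.1) <| by
    simpa [sub_eq_add_neg] using T_mul_pair_mem_nonpos hv.2 hv'.2

end Dual

variable (L)

/-- The first cohomology module of a twist is finitely generated over `B`: it is the quotient of
`E` by `chart₀ ⊔ chart₁ d`, and is spanned by the finitely many `T k • x a` that lie in neither
chart. -/
theorem exists_fg_sup_eq_top (d : ℤ) :
    ∃ F : Submodule B E, F.FG ∧ L.chart₀ ⊔ L.chart₁ d ⊔ F = ⊤ := by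
  classical
  have hK : ∀ a, ∃ K : ℕ, ∀ k ≤ -(K : ℤ), (T k : B[T;T⁻¹]) • L.x a ∈ L.chart₁ d := by
    intro a
    have h : ∀ c, ∃ K : ℕ, ∀ k ≤ -(K : ℤ), T k * L.pair (L.x a) (L.y' c) ∈ nonpos B :=
      fun c => exists_T_mul_mem_nonpos _
    choose K hK using h
    refine ⟨(Finset.univ.sup K) + d.natAbs, fun k hk c => ?_⟩
    rw [map_smul, LinearMap.smul_apply, smul_eq_mul, ← mul_assoc, ← T_add]
    have := Finset.le_sup (f := K) (Finset.mem_univ c)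
    exact hK c _ (by rw [Nat.cast_add] at hk; omega)
  choose K hK using hK
  let S : Finset E := Finset.univ.biUnion fun a =>
    (Finset.Ioo (-(K a : ℤ)) 0).image fun k => (T k : B[T;T⁻¹]) • L.x a
  refine ⟨Submodule.span B S, ⟨S, rfl⟩, ?_⟩
  rw [eq_top_iff]
  rintro v -
  rw [L.expand_x v]
  refine sum_mem fun a _ => ?_
  generalize L.pair v (L.x' a) = r
  induction r using LaurentPolynomial.induction_on' with
  | add p q hp hq => rw [add_smul]; exact add_mem hp hq
  | C_mul_T k b =>
    rw [mul_smul, C_eq_algebraMap, algebraMap_smul]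
    refine Submodule.smul_mem _ _ ?_
    rcases le_or_gt 0 k with hk | hk
    · exact Submodule.mem_sup_left (Submodule.mem_sup_left
        (smul_mem_chart₀ (T_mem_nonneg hk) (x_mem_chart₀ a)))
    rcases le_or_gt k (-(K a : ℤ)) with hk' | hk'
    · exact Submodule.mem_sup_left (Submodule.mem_sup_right (hK a k hk'))
    · refine Submodule.mem_sup_right (Submodule.subset_span ?_)
      simp only [S, Finset.coe_biUnion, Finset.coe_image, Set.mem_iUnion]
      exact ⟨a, by simp, k, by simpa using ⟨hk', hk⟩, rfl⟩

section Fibre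

variable {k : Type*} [Field k] (φ : B →+* k)

theorem red_pair_eq_of_sub_mem {v w : E} (h : v - w ∈ RingHom.ker φ • (⊤ : Submodule B E))
    (v' : E') : red φ (L.pair v v') = red φ (L.pair w v') := by
  rw [← sub_eq_zero, ← map_sub, ← LinearMap.sub_apply, ← map_sub]
  refine Submodule.smul_induction_on h (fun b hb u _ => ?_) (fun u u' hu hu' => ?_)
  · rw [← algebraMap_smul B[T;T⁻¹] b u, map_smul, LinearMap.smul_apply, smul_eq_mul, map_mul,
      ← C_eq_algebraMap, red_C, (RingHom.mem_ker).1 hb, map_zero, zero_mul]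
  · rw [map_add, LinearMap.add_apply, map_add, hu, hu', add_zero]

/-- If the fibre of the sheaf over `φ : B → k` is `𝒪(-d)`, then a generating section of the fibre
of its twist by `𝒪(d)` lifts to a global section of that twist. As the first cohomology of the
trivial bundle on the fibre vanishes, so does, by Nakayama's lemma, that of the twist, after
multiplication by an element of `B` that is `1` in `k`. -/
theorem exists_section_lift (hφ : Function.Surjective φ) {d : ℤ} {v : E} {v' : E'} {w : E}
    {w' : E'} (hv : v ∈ L.chart₀) (hvv : red φ (L.pair v v') = 1) (hw : w ∈ L.chart₁ 0)
    (hww : red φ (L.pair w w') = 1) {c : k} (hvw : red φ (L.pair v w') = C c * T (-d)) :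
    ∃ s ∈ L.sections d, s - v ∈ RingHom.ker φ • (⊤ : Submodule B E) := by
  set I := RingHom.ker φ with hI
  obtain ⟨b, rfl⟩ := hφ c
  -- the generator of the fibre, as seen from the chart at infinity
  let u : E := (C b * T (-d) : B[T;T⁻¹]) • w
  have hu_mem : ∀ r ∈ nonpos B, r • u ∈ L.chart₁ d := fun r hr => by
    rw [← mul_smul]
    refine smul_mem_chart₁ ?_ hw
    have h : T (d - 0) * (r * (C b * T (-d))) = r * C b := by
      rw [sub_zero]
      have : (T d * T (-d) : B[T;T⁻¹]) = 1 := by rw [← T_add]; simp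
      linear_combination (r * C b) * this
    rw [h]
    exact mul_mem hr (C_mem_nonpos b)
  have hvu : v - u ∈ I • (⊤ : Submodule B E) := by
    have h1 : v - u = (1 - L.pair w w') • v + (L.pair v w' - C b * T (-d)) • w := by
      rw [sub_smul, sub_smul, one_smul, L.exchange w w' v]
      abel
    rw [h1]
    refine add_mem (smul_mem_of_red_eq_zero φ ?_ v) (smul_mem_of_red_eq_zero φ ?_ w)
    · rw [map_sub, map_one, hww, sub_self]
    · rw [map_sub, hvw, map_mul, red_C, red_T, sub_self]
  have hR : ∀ (r : B[T;T⁻¹]) (z : E), z ∈ I • (⊤ : Submodule B E) →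
      r • z ∈ I • (⊤ : Submodule B E) := fun r z hz => by
    refine Submodule.smul_induction_on hz (fun a ha z _ => ?_) (fun z z' hz hz' => ?_)
    · rw [← algebraMap_smul B[T;T⁻¹] a z, smul_smul]
      refine smul_mem_of_red_eq_zero φ ?_ z
      rw [map_mul, ← C_eq_algebraMap, red_C, (RingHom.mem_ker).1 ha, map_zero, mul_zero]
    · rw [smul_add]; exact add_mem hz hz'
  have htop : (⊤ : Submodule B E) ≤ L.chart₀ ⊔ L.chart₁ d ⊔ I • ⊤ := by
    rintro z -
    obtain ⟨g, hg, h, hh, hgh⟩ := exists_nonneg_add_nonpos (L.pair z v')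
    have h1 : z = g • v + h • u + ((1 - L.pair v v') • z + h • (v - u)) := by
      rw [sub_smul, one_smul, L.exchange v v' z, hgh, add_smul, smul_sub]
      abel
    rw [h1]
    refine add_mem (Submodule.mem_sup_left (add_mem (Submodule.mem_sup_left
      (smul_mem_chart₀ hg hv)) (Submodule.mem_sup_right (hu_mem h hh))))
      (Submodule.mem_sup_right (add_mem (smul_mem_of_red_eq_zero φ ?_ z) (hR _ _ hvu)))
    rw [map_sub, map_one, hvv, sub_self]
  obtain ⟨F, hF, hFtop⟩ := L.exists_fg_sup_eq_top d
  have hIF : (⊤ : Submodule B E) ≤ L.chart₀ ⊔ L.chart₁ d ⊔ I • F := by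
    refine htop.trans (sup_le le_sup_left ?_)
    rw [← hFtop, Submodule.smul_sup]
    exact sup_le_sup_right Submodule.smul_le_right _
  obtain ⟨f, hf, hfN⟩ := Submodule.exists_sub_one_mem_and_smul_le_of_fg_of_le_sup hF le_top hIF
  have hfI : ∀ z ∈ I • (⊤ : Submodule B E), ∃ z₀ ∈ L.chart₀, ∃ z₁ ∈ L.chart₁ d,
      z₀ ∈ I • (⊤ : Submodule B E) ∧ f • z = z₀ + z₁ := fun z hz => by
    refine Submodule.smul_induction_on hz (fun a ha z _ => ?_) ?_
    · obtain ⟨z₀, h₀, z₁, h₁, h⟩ := Submodule.mem_sup.1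
        (hfN (Submodule.smul_mem_pointwise_smul z f ⊤ trivial))
      exact ⟨a • z₀, Submodule.smul_mem _ _ h₀, a • z₁, Submodule.smul_mem _ _ h₁,
        Submodule.smul_mem_smul ha trivial, by rw [smul_comm, ← h, smul_add]⟩
    · rintro z z' ⟨z₀, h₀, z₁, h₁, h, e⟩ ⟨z₀', h₀', z₁', h₁', h', e'⟩
      exact ⟨_, add_mem h₀ h₀', _, add_mem h₁ h₁', add_mem h h', by
        rw [smul_add, e, e']; abel⟩
  obtain ⟨z₀, h₀, z₁, h₁, hz, e⟩ := hfI _ hvu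
  refine ⟨f • v - z₀, ⟨sub_mem (Submodule.smul_mem _ _ hv) h₀, ?_⟩, ?_⟩
  · have : f • v - z₀ = f • u + z₁ := by
      rw [smul_sub] at e
      rw [sub_eq_iff_eq_add, add_assoc, add_comm z₁, ← e]
      abel
    rw [this]
    refine add_mem (Submodule.smul_mem _ _ ?_) h₁
    simpa using hu_mem 1 (one_mem _)
  · have : f • v - z₀ - v = (f - 1) • v - z₀ := by rw [sub_smul, one_smul]; abel
    rw [this]
    exact sub_mem (Submodule.smul_mem_smul hf trivial) hz

end Fibre

end Glued

namespace Glued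

variable {B E E' ι κ : Type*} [CommRing B] [AddCommGroup E] [Module B[T;T⁻¹] E]
    [AddCommGroup E'] [Module B[T;T⁻¹] E'] [Fintype ι] [Fintype κ]
    (L : Glued B E E' ι κ)

/-- On a fibre, either chart of the projective line is an affine line over a field, on which every
invertible sheaf is trivial. The embedding of the coordinate ring of the chart into the ring of
Laurent polynomials is `j` over `B`, and `jk` over the field. -/
theorem exists_fibre_generator {k : Type*} [Field k] {φ : B →+* k} (hφ : Function.Surjective φ)
    {j : B[X] →+* B[T;T⁻¹]} {jk : k[X] →+* k[T;T⁻¹]} (hjk : Function.Injective jk)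
    (hred : ∀ p, red φ (j p) = jk (p.map φ)) {α : Type*} [Fintype α] (x : α → E) (x' : α → E')
    (hx : ∀ a c, L.pair (x a) (x' c) ∈ j.range) (hsum : ∑ a, L.pair (x a) (x' a) = 1) :
    ∃ c u : α → B[X],
      red φ (L.pair (∑ a, j (c a) • x a) (∑ b, j (u b) • x' b)) = 1 := by
  choose G hG using hx
  have hGk : ∀ a b, red φ (L.pair (x a) (x' b)) = jk ((G a b).map φ) := fun a b => by
    rw [← hG, hred]
  obtain ⟨c, u, hcu⟩ := exists_sum_mul_eq_one (fun a b => (G a b).map φ)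
    (fun a b c d => hjk (by
      simp only [map_mul, ← hGk]
      rw [← map_mul, L.pair_mul_pair, map_mul]))
    (hjk (by simp only [map_sum, ← hGk]; rw [← map_sum, hsum, map_one, map_one]))
  have hlift : ∀ p : k[X], ∃ q : B[X], q.map φ = p := Polynomial.map_surjective φ hφ
  choose l hl using hlift
  refine ⟨fun a => l (c a), fun b => l (u b), ?_⟩
  have := congrArg jk hcu
  simp only [map_sum, map_mul, map_one, ← hGk] at this
  simp only [map_sum, LinearMap.sum_apply, map_smul, LinearMap.smul_apply, smul_eq_mul, map_mul,
    hred, hl, ← this]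
  simp only [Finset.mul_sum]
  rw [Finset.sum_comm]
  exact Finset.sum_congr rfl fun a _ => Finset.sum_congr rfl fun b _ => by ring

variable [Module B E] [IsScalarTower B B[T;T⁻¹] E] [Module B E'] [IsScalarTower B B[T;T⁻¹] E']

/-- The ideal of `B` generated by the values of global sections of the twist by `𝒪(d)` on those of
its dual. Its zero locus consists of the points whose fibre has degree different from `-d`. -/
def degIdeal (d : ℤ) : Ideal B :=
  Ideal.span {b | ∃ s ∈ L.sections d, ∃ s' ∈ L.flip.sections (-d), L.pair s s' = C b}

theorem mul_eq_zero_of_mem_degIdeal {d e : ℤ} (hde : d ≠ e) {b c : B} (hb : b ∈ L.degIdeal d)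
    (hc : c ∈ L.degIdeal e) : b * c = 0 := by
  have h : L.degIdeal d * L.degIdeal e = ⊥ := by
    rw [degIdeal, degIdeal, Ideal.span_mul_span', Ideal.span_eq_bot]
    rintro _ ⟨b, ⟨s, hs, s', hs', hb⟩, c, ⟨r, hr, r', hr', hc⟩, rfl⟩
    have h0 : (C (b * c) : B[T;T⁻¹]) = C 0 := by
      rw [map_mul, ← hb, ← hc, L.pair_mul_pair, map_zero]
      rcases lt_or_gt_of_ne hde with h | h
      · rw [pair_sections_eq_zero h hr hs', mul_zero]
      · rw [pair_sections_eq_zero h hs hr', zero_mul]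
    have := congrArg (fun f => f.coeff 0) h0
    simpa only [C_apply, if_true] using this
  have := Ideal.mul_mem_mul hb hc
  rwa [h] at this

theorem exists_not_degIdeal_le (m : Ideal B) [m.IsMaximal] : ∃ d, ¬ L.degIdeal d ≤ m := by
  let k := B ⧸ m
  let : Field k := Ideal.Quotient.field m
  let φ : B →+* k := Ideal.Quotient.mk m
  have hφ : Function.Surjective φ := Ideal.Quotient.mk_surjective
  obtain ⟨c, u, hcu⟩ := L.exists_fibre_generator hφ (j := toLaurent) (jk := toLaurent)
    Polynomial.toLaurent_injective (red_toLaurent φ) L.x L.x'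
    (fun a c => L.x_mem a c) L.x_sum
  obtain ⟨c', u', hcu'⟩ := L.exists_fibre_generator hφ
    (j := (invert (R := B)).toRingHom.comp toLaurent)
    (jk := (invert (R := k)).toRingHom.comp toLaurent)
    ((invert (R := k)).injective.comp Polynomial.toLaurent_injective)
    (fun p => (red_invert φ _).trans (congrArg _ (red_toLaurent φ p))) L.y L.y'
    (fun a c => L.y_mem a c) L.y_sum
  have hj : ∀ p : B[X], toLaurent p ∈ nonneg B := fun p => ⟨p, rfl⟩
  have hj' : ∀ p : B[X], (invert (R := B)).toRingHom.comp toLaurent p ∈ nonpos B :=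
    fun p => ⟨p, rfl⟩
  set v := ∑ a, toLaurent (c a) • L.x a
  set v' := ∑ a, toLaurent (u a) • L.x' a
  set w := ∑ a, (invert (R := B)).toRingHom.comp toLaurent (c' a) • L.y a
  set w' := ∑ a, (invert (R := B)).toRingHom.comp toLaurent (u' a) • L.y' a
  have hv : v ∈ L.chart₀ := sum_mem fun a _ => smul_mem_chart₀ (hj _) (x_mem_chart₀ a)
  have hv' : v' ∈ L.flip.chart₀ :=
    sum_mem fun a _ => smul_mem_chart₀ (hj _) (x_mem_chart₀ (L := L.flip) a)
  have hw : w ∈ L.chart₁ 0 := sum_mem fun a _ =>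
    smul_mem_chart₁ (e := 0) (by simpa using hj' _) (y_mem_chart₁ a)
  have hw' : w' ∈ L.flip.chart₁ 0 := sum_mem fun a _ =>
    smul_mem_chart₁ (e := 0) (by simpa using hj' _) (y_mem_chart₁ (L := L.flip) a)
  -- the transition function of the fibre is a unit, hence a monomial
  have hunit : red φ (L.pair v w') * red φ (L.pair w v') = 1 := by
    rw [← map_mul, ← L.pair_mul_pair, map_mul, hcu, hcu', mul_one]
  obtain ⟨a, d, -, h1, h2⟩ := exists_eq_C_mul_T_of_mul_eq_one hunit
  obtain ⟨s, hs, hsv⟩ := L.exists_section_lift φ hφ (d := -d) hv hcu hw hcu'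
    (by rw [h1, neg_neg])
  obtain ⟨s', hs', hsv'⟩ := L.flip.exists_section_lift φ hφ (d := d) hv' hcu hw' hcu' h2
  refine ⟨-d, fun hle => ?_⟩
  have hs'd : s' ∈ L.flip.sections (- -d) := by rwa [neg_neg]
  have hss : L.pair s s' = C ((L.pair s s').coeff 0) := pair_sections_eq_C hs hs'd
  have hmem := hle (Ideal.subset_span ⟨s, hs, s', hs'd, hss⟩)
  have hone : red φ (L.pair s s') = 1 := by
    rw [L.red_pair_eq_of_sub_mem φ hsv s', ← hcu]
    exact L.flip.red_pair_eq_of_sub_mem φ hsv' v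
  rw [hss, red_C, Ideal.Quotient.eq_zero_iff_mem.2 hmem, map_zero] at hone
  exact zero_ne_one hone

theorem iSup_degIdeal : ⨆ d, L.degIdeal d = ⊤ := by
  by_contra h
  obtain ⟨m, hm, hle⟩ := Ideal.exists_le_maximal _ h
  obtain ⟨d, hd⟩ := L.exists_not_degIdeal_le m
  exact hd ((le_iSup _ d).trans hle)

/-- The ideals `degIdeal d` decompose `1` into orthogonal idempotents, so that the degree of an
invertible sheaf is constant over a connected base. -/
theorem exists_degIdeal_eq_top (hB : ∀ e : B, e * (1 - e) = 0 → e = 0 ∨ e = 1) :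
    ∃ d, L.degIdeal d = ⊤ := by
  classical
  have h1 : (1 : B) ∈ ⨆ d, L.degIdeal d := by rw [iSup_degIdeal]; trivial
  obtain ⟨f, hf, hsum⟩ := (Submodule.mem_iSup_iff_exists_finsupp _ _).1 h1
  rw [Finsupp.sum] at hsum
  have hidem : ∀ d, f d * (1 - f d) = 0 := fun d => by
    have h2 : f d * 1 = f d * f d := by
      conv_lhs => rw [← hsum, Finset.mul_sum]
      rw [Finset.sum_eq_single d]
      · intro e _ hed
        exact L.mul_eq_zero_of_mem_degIdeal hed.symm (hf d) (hf e)
      · intro hd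
        rw [Finsupp.notMem_support_iff.1 hd, mul_zero]
    rw [mul_sub, h2, sub_self]
  by_cases hall : ∀ d, f d = 0
  · have h3 : (1 : B) = 0 := by rw [← hsum]; exact Finset.sum_eq_zero fun d _ => hall d
    exact ⟨0, (Ideal.eq_top_iff_one _).2 (h3 ▸ zero_mem _)⟩
  · push Not at hall
    obtain ⟨d, hd⟩ := hall
    refine ⟨d, (Ideal.eq_top_iff_one _).2 ?_⟩
    rw [← (hB _ (hidem d)).resolve_left hd]
    exact hf d

/-- An invertible sheaf on the projective line over a connected ring which is trivial on the
section `T = 0`, as witnessed by `z` and `z'`, is isomorphic to some `𝒪(-d)`: its twist by `𝒪(d)`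
and the dual of this twist have global sections `s` and `s'` that are inverse to each other. -/
theorem exists_trivialization (hB : ∀ e : B, e * (1 - e) = 0 → e = 0 ∨ e = 1) {z : E} {z' : E'}
    (hz : z ∈ L.chart₀) (hz' : z' ∈ L.flip.chart₀) (hzz : (L.pair z z').coeff 0 = 1) :
    ∃ d, ∃ s ∈ L.sections d, ∃ s' ∈ L.flip.sections (-d),
      L.pair s s' = 1 ∧ (L.pair s z').coeff 0 = 1 := by
  obtain ⟨d, hd⟩ := L.exists_degIdeal_eq_top hB
  have h1 : (1 : B) ∈ L.degIdeal d := by rw [hd]; trivial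
  obtain ⟨n, s, s', hs, hs', hsum⟩ : ∃ (n : ℕ) (s : Fin n → E) (s' : Fin n → E'),
      (∀ a, s a ∈ L.sections d) ∧ (∀ a, s' a ∈ L.flip.sections (-d)) ∧
        ∑ a, L.pair (s a) (s' a) = 1 := by
    obtain ⟨n, β, g, hg⟩ := Submodule.mem_span_set'.1 h1
    choose s hs s' hs' hss using fun a => (g a).2
    refine ⟨n, fun a => β a • s a, s', fun a => Submodule.smul_mem _ _ (hs a), hs', ?_⟩
    rw [← map_one C, ← hg, map_sum]
    refine Finset.sum_congr rfl fun a _ => ?_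
    beta_reduce
    rw [← algebraMap_smul B[T;T⁻¹] (β a) (s a), map_smul, LinearMap.smul_apply, hss, smul_eq_mul,
      smul_eq_mul, map_mul, ← C_eq_algebraMap]
  -- evaluating at `T = 0` makes `s` and `s'` into scalars, and `∑ s a * s' a = 1` splits
  let α : Fin n → B := fun a => (L.pair z (s' a)).coeff 0
  let α' : Fin n → B := fun a => (L.pair (s a) z').coeff 0
  have hα : ∑ a, α a * α' a = 1 := by
    have : ∀ a, α a * α' a = (L.pair z z' * L.pair (s a) (s' a)).coeff 0 := fun a => by
      rw [L.pair_mul_pair, coeff_zero_mul (pair_mem_nonneg hz (hs' a).1)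
        (pair_mem_nonneg (hs a).1 hz')]
    rw [Finset.sum_congr rfl fun a _ => this a, ← Finset.sum_apply', ← AddMonoidAlgebra.coeff_sum,
      ← Finset.mul_sum, hsum, mul_one, hzz]
  have hS : ∑ a, α a • s a ∈ L.sections d := sum_mem fun a _ => Submodule.smul_mem _ _ (hs a)
  have hS' : ∑ a, α' a • s' a ∈ L.flip.sections (-d) :=
    sum_mem fun a _ => Submodule.smul_mem _ _ (hs' a)
  have hSz : (L.pair (∑ a, α a • s a) z').coeff 0 = 1 := by
    rw [map_sum, LinearMap.sum_apply, AddMonoidAlgebra.coeff_sum, Finset.sum_apply', ← hα]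
    refine Finset.sum_congr rfl fun a _ => ?_
    rw [← algebraMap_smul B[T;T⁻¹], map_smul, LinearMap.smul_apply, smul_eq_mul,
      ← C_eq_algebraMap, coeff_zero_mul (C_mem_nonneg _) (pair_mem_nonneg (hs a).1 hz'),
      C_apply, if_pos rfl]
  have hzS : (L.pair z (∑ a, α' a • s' a)).coeff 0 = 1 := by
    rw [map_sum, AddMonoidAlgebra.coeff_sum, Finset.sum_apply', ← hα]
    refine Finset.sum_congr rfl fun a _ => ?_
    rw [← algebraMap_smul B[T;T⁻¹], map_smul, smul_eq_mul, mul_comm (α a),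
      ← C_eq_algebraMap, coeff_zero_mul (C_mem_nonneg _) (pair_mem_nonneg hz (hs' a).1),
      C_apply, if_pos rfl]
  refine ⟨d, _, hS, _, hS', ?_, hSz⟩
  -- the value of one global section on another is a constant, hence its own value at `T = 0`
  have h2 := congrArg (fun f => f.coeff 0)
    (L.pair_mul_pair (∑ a, α a • s a) z (∑ a, α' a • s' a) z')
  rw [coeff_zero_mul (pair_mem_nonneg hS.1 hS'.1) (pair_mem_nonneg hz hz'),
    coeff_zero_mul (pair_mem_nonneg hS.1 hz') (pair_mem_nonneg hz hS'.1), hzz, hSz, hzS,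
    mul_one, mul_one] at h2
  rw [pair_sections_eq_C hS hS', h2, map_one]

end Glued
end LaurentLine

/-! ### Projective modules of rank one -/

namespace ProjCover

section RankOne

variable {R M : Type*} [CommRing R] [AddCommGroup M] [Module R M]

/-- Locally a projective module of rank one is generated by a single element, so that the two
arguments of a linear form and a vector may be exchanged. -/
theorem IsProjRankOne.exchange (h : IsProjRankOne R M) (f : Module.Dual R M) (x y : M) :
    f x • y = f y • x := by
  have := h.finite
  have := h.projective
  refine Module.eq_of_localization_maximal _
    (fun (P : Ideal R) _ => LocalizedModule.mkLinearMap P.primeCompl M) _ _ fun P hP => ?_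
  let p : PrimeSpectrum R := ⟨P, hP.isPrime⟩
  let S := P.primeCompl
  have hfree : Module.Free (Localization S) (LocalizedModule S M) :=
    Set.eq_univ_iff_forall.1 (Module.freeLocus_eq_univ (R := R) (M := M)) p
  have hrank : Module.finrank (Localization S) (LocalizedModule S M) = 1 := h.rank_eq_one p
  obtain ⟨e, -, he⟩ := finrank_eq_one_iff'.1 hrank
  let g : LocalizedModule S M →ₗ[Localization S] Localization S :=
    IsLocalizedModule.mapExtendScalars S (LocalizedModule.mkLinearMap S M)
      (Algebra.linearMap R (Localization S)) (Localization S) f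
  have hg : ∀ z, algebraMap R (Localization S) (f z) = g (LocalizedModule.mkLinearMap S M z) :=
    fun z => (IsLocalizedModule.map_apply S (LocalizedModule.mkLinearMap S M)
      (Algebra.linearMap R (Localization S)) f z).symm
  rw [map_smul, map_smul, ← algebraMap_smul (Localization S) (f x),
    ← algebraMap_smul (Localization S) (f y), hg, hg]
  obtain ⟨a, ha⟩ := he (LocalizedModule.mkLinearMap S M x)
  obtain ⟨b, hb⟩ := he (LocalizedModule.mkLinearMap S M y)
  change g (LocalizedModule.mkLinearMap S M x) • LocalizedModule.mkLinearMap S M y =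
    g (LocalizedModule.mkLinearMap S M y) • LocalizedModule.mkLinearMap S M x
  rw [← ha, ← hb, map_smul, map_smul, smul_smul, smul_smul]
  congr 1
  simp only [smul_eq_mul]
  ring

/-- A projective module of rank one is faithful, so its trace ideal, which does not shrink it, is
the unit ideal. -/
theorem IsProjRankOne.contractLeft_surjective (h : IsProjRankOne R M) :
    Function.Surjective (contractLeft R M) := by
  have := h.finite
  have := h.projective
  rw [← LinearMap.range_eq_top]
  set J : Ideal R := LinearMap.range (contractLeft R M) with hJ
  have hmem : ∀ (f : Module.Dual R M) x, f x ∈ J := fun f x => ⟨f ⊗ₜ x, contractLeft_apply f x⟩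
  by_contra hne
  obtain ⟨m, hm, hle⟩ := Ideal.exists_le_maximal J hne
  obtain ⟨s, hs⟩ := (Module.projective_def' (R := R) (P := M)).1 inferInstance
  have htop : (⊤ : Submodule R M) ≤ J • ⊤ := by
    rintro x -
    have hx : x = (s x).sum fun a r => r • a := by
      conv_lhs => rw [← LinearMap.id_apply (R := R) x, ← hs]
      simp [Finsupp.linearCombination_apply]
    rw [hx]
    exact Submodule.sum_mem _ fun a _ =>
      Submodule.smul_mem_smul (hmem ((Finsupp.lapply a).comp s) x) trivial
  obtain ⟨r, hr, hr0⟩ := Submodule.exists_sub_one_mem_and_smul_eq_zero_of_fg_of_le_smul J ⊤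
    Module.Finite.fg_top htop
  have hsupp : (⟨m, hm.isPrime⟩ : PrimeSpectrum R) ∈ Module.support R M := by
    rw [← Module.rankAtStalk_pos_iff_mem_support, h.rank_eq_one]
    exact one_pos
  obtain ⟨x, hx⟩ := Module.mem_support_iff_exists_annihilator.1 hsupp
  have hrm : r ∈ m := hx (Submodule.mem_annihilator_span_singleton x r |>.2 (hr0 x trivial))
  exact hm.ne_top ((Ideal.eq_top_iff_one m).2 (by
    have := sub_mem hrm (hle hr)
    rwa [sub_sub_cancel] at this))

theorem IsProjRankOne.invertible (h : IsProjRankOne R M) : Module.Invertible R M := by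
  refine ⟨⟨?_, h.contractLeft_surjective⟩⟩
  have hex : ∀ (f g : Module.Dual R M) (x : M), f x • g = g x • f := fun f g x => by
    ext y
    have := congrArg g (h.exchange f x y)
    simpa [mul_comm] using this
  obtain ⟨t, ht⟩ := h.contractLeft_surjective 1
  -- `contractLeft u • t = contractLeft t • u`, by the exchange laws
  have key : ∀ u t : Module.Dual R M ⊗[R] M,
      contractLeft R M u • t = contractLeft R M t • u := fun u t => by
    induction u with
    | zero => simp
    | add u u' hu hu' => rw [map_add, add_smul, hu, hu', smul_add]
    | tmul f x =>
      induction t with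
      | zero => simp
      | add t t' ht ht' => rw [map_add, add_smul, smul_add, ht, ht']
      | tmul g y =>
        rw [contractLeft_apply, contractLeft_apply, TensorProduct.smul_tmul', hex f g x,
          ← TensorProduct.smul_tmul', TensorProduct.smul_tmul', TensorProduct.smul_tmul,
          ← h.exchange g y x, ← TensorProduct.tmul_smul]
  refine (injective_iff_map_eq_zero _).2 fun u hu => ?_
  have := key u t
  rw [hu, ht, zero_smul, one_smul] at this
  exact this.symm

end RankOne

section Invertible

variable {R M : Type*} [CommRing R] [AddCommGroup M] [Module R M] [Module.Invertible R M]

theorem dual_exchange (f : Module.Dual R M) (x y : M) : f x • y = f y • x := by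
  have := congrArg (TensorProduct.lift ((LinearMap.lsmul R M).comp f))
    (Module.Invertible.tmul_comm (R := R) (m₁ := x) (m₂ := y))
  simpa using this

theorem dual_exchange' (f g : Module.Dual R M) (x : M) : f x • g = g x • f := by
  ext y
  have := congrArg g (dual_exchange f x y)
  simpa [mul_comm] using this

variable (R M) in
theorem exists_sum_dual_eq_one : ∃ (m : ℕ) (f : Fin m → Module.Dual R M) (x : Fin m → M),
    ∑ a, f a (x a) = 1 := by
  obtain ⟨t, ht⟩ := (Module.Invertible.bijective (R := R) (M := M)).2 1
  obtain ⟨S, rfl⟩ := TensorProduct.exists_finset t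
  refine ⟨S.card, fun a => (S.equivFin.symm a).1.1, fun a => (S.equivFin.symm a).1.2, ?_⟩
  rw [map_sum] at ht
  simp only [contractLeft_apply] at ht
  rw [← ht, ← Finset.sum_coe_sort S, ← S.equivFin.symm.sum_comp]

/-- A linear form on an invertible module that takes the value `1` is an isomorphism. -/
noncomputable def equivOfDualApplyEqOne (f : Module.Dual R M) (x : M) (h : f x = 1) :
    M ≃ₗ[R] R :=
  LinearEquiv.ofLinearMap f (LinearMap.toSpanSingleton R M x)
    (by ext; simp [h]) (by ext y; simp [dual_exchange f y x, h])

end Invertible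

end ProjCover

/-! ### The overlap of two charts as a Laurent polynomial ring -/

namespace ProjCover

section Overlap

variable {n : ℕ}

/-- The exponents of the monomials of `T_{ij}(A)` in which `X_i` does not occur. Their monoid
algebra is the polynomial ring in the `X_l / X_j`, `l ≠ i, j`, the coordinate ring of the chart `j`
of the hyperplane `X_i = 0`. -/
def baseExpts (i j : Fin (n + 1)) : AddSubmonoid (degZero n) where
  carrier := {p | p ∈ expts {i, j} ∧ p.1 i = 0}
  zero_mem' := ⟨zero_mem _, rfl⟩
  add_mem' := fun hp hq => ⟨add_mem hp.1 hq.1, by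
    rw [AddSubgroup.coe_add, Pi.add_apply, hp.2, hq.2, add_zero]⟩

theorem mem_TS {A : Type*} [CommRing A] {S : Set (Fin (n + 1))} {u : T A n} :
    u ∈ TS A S ↔ ∀ p, u.coeff p ≠ 0 → p ∈ expts S := by
  simp only [← Finsupp.mem_support_iff]
  exact Iff.rfl

theorem sum_eq_zero (p : degZero n) : ∑ l, p.1 l = 0 := p.2

theorem zsmul_ratioExp_apply (i j l : Fin (n + 1)) (k : ℤ) :
    (k • ratioExp i j).1 l = (if l = j then k else 0) - (if l = i then k else 0) := by
  simp [ratioExp, Pi.single_apply, mul_sub]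

theorem add_zsmul_ratioExp_mem {i j : Fin (n + 1)} {p : degZero n} (hp : p ∈ expts {i, j})
    (k : ℤ) : p + k • ratioExp i j ∈ expts {i, j} := fun l hl => by
  have h1 : l ≠ i := fun h => hl (by simp [h])
  have h2 : l ≠ j := fun h => hl (by simp [h])
  rw [AddSubgroup.coe_add, Pi.add_apply, zsmul_ratioExp_apply, if_neg h1, if_neg h2]
  simpa using hp l hl

/-- Splitting off the power of `X_j / X_i` that removes `X_i` from a monomial of `T_{ij}(A)`. -/
def exptsEquiv {i j : Fin (n + 1)} (hij : i ≠ j) : expts {i, j} ≃+ ℤ × baseExpts i j where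
  toFun p := (-p.1.1 i, ⟨p.1 + p.1.1 i • ratioExp i j, add_zsmul_ratioExp_mem p.2 _, by
    rw [AddSubgroup.coe_add, Pi.add_apply, zsmul_ratioExp_apply, if_neg hij, if_pos rfl]; ring⟩)
  invFun q := ⟨q.2.1 + q.1 • ratioExp i j, add_zsmul_ratioExp_mem q.2.2.1 _⟩
  left_inv p := by ext; simp
  right_inv q := by
    have h : (q.2.1 + q.1 • ratioExp i j).1 i = -q.1 := by
      rw [AddSubgroup.coe_add, Pi.add_apply, zsmul_ratioExp_apply, if_neg hij, if_pos rfl,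
        q.2.2.2]
      ring
    refine Prod.ext ?_ (Subtype.ext ?_)
    · change -(q.2.1 + q.1 • ratioExp i j).1 i = q.1
      rw [h, neg_neg]
    · change q.2.1 + q.1 • ratioExp i j + (q.2.1 + q.1 • ratioExp i j).1 i • ratioExp i j = q.2.1
      rw [h, neg_smul, add_neg_cancel_right]
  map_add' p q := by
    refine Prod.ext ?_ (Subtype.ext ?_)
    · change -(p.1.1 i + q.1.1 i) = -p.1.1 i + -q.1.1 i
      ring
    · change p.1 + q.1 + (p.1.1 i + q.1.1 i) • ratioExp i j =
        p.1 + p.1.1 i • ratioExp i j + (q.1 + q.1.1 i • ratioExp i j)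
      rw [add_smul]
      abel

variable (A : Type*) [CommRing A]

/-- `T_S(A)` is the monoid algebra of its exponents. -/
noncomputable def monoidAlgebraEquivTS (S : Set (Fin (n + 1))) :
    AddMonoidAlgebra A (expts S) ≃+* TS A S :=
  RingEquiv.ofBijective
    ((AddMonoidAlgebra.mapDomainRingHom A (expts S).subtype).codRestrict (TS A S) fun v => by
      classical
      intro p hp
      obtain ⟨q, -, rfl⟩ := Finset.mem_image.1 (Finsupp.mapDomain_support hp)
      exact q.2)
    ⟨fun v w h => AddMonoidAlgebra.mapDomain_injective Subtype.val_injective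
      (congrArg Subtype.val h), fun u => by
      refine ⟨.ofCoeff (u.1.coeff.comapDomain Subtype.val Subtype.val_injective.injOn), ?_⟩
      refine Subtype.ext (AddMonoidAlgebra.ext ?_)
      exact Finsupp.mapDomain_comapDomain _ Subtype.val_injective _
        fun p hp => ⟨⟨p, u.2 p hp⟩, rfl⟩⟩

theorem coeff_monoidAlgebraEquivTS {S : Set (Fin (n + 1))} (v : AddMonoidAlgebra A (expts S))
    (p : expts S) : (monoidAlgebraEquivTS A S v).1.coeff p.1 = v.coeff p :=
  Finsupp.mapDomain_apply Subtype.val_injective v.coeff p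

/-- `T_{ij}(A)` is a Laurent polynomial ring in `X_j / X_i`. -/
noncomputable def laurentEquiv {i j : Fin (n + 1)} (hij : i ≠ j) :
    T₂ A i j ≃+* LaurentPolynomial (AddMonoidAlgebra A (baseExpts i j)) :=
  (monoidAlgebraEquivTS A {i, j}).symm.trans
    ((AddMonoidAlgebra.domCongr A A (exptsEquiv hij)).toRingEquiv.trans
      AddMonoidAlgebra.curryRingEquiv)

theorem coeff_laurentEquiv {i j : Fin (n + 1)} (hij : i ≠ j) (u : T₂ A i j) (k : ℤ)
    (g : baseExpts i j) :
    ((laurentEquiv A hij u).coeff k).coeff g = u.1.coeff (g.1 + k • ratioExp i j) := by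
  obtain ⟨v, rfl⟩ := (monoidAlgebraEquivTS A {i, j}).surjective u
  have h := coeff_monoidAlgebraEquivTS A v ((exptsEquiv hij).symm (k, g))
  refine Eq.trans ?_ h.symm
  simp only [laurentEquiv, RingEquiv.trans_apply, RingEquiv.symm_apply_apply]
  change (AddMonoidAlgebra.domCongr A A (exptsEquiv hij) v).coeff (k, g) = _
  simp

end Overlap

/-! ### Monoid algebras of positively graded monoids -/

section PositiveGrading

variable (A : Type*) [CommRing A] {G : Type*} [AddCommMonoid G]

/-- The augmentation of the algebra of a monoid in which `0` is not a sum of nonzero elements: it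
takes an element to its constant coefficient. -/
noncomputable def constCoeff (hG : ∀ a b : G, a + b = 0 → a = 0) : AddMonoidAlgebra A G →ₐ[A] A :=
  open Classical in
  AddMonoidAlgebra.lift A A G
    { toFun g := if g.toAdd = 0 then 1 else 0
      map_one' := by simp
      map_mul' a b := by
        rw [toAdd_mul]
        by_cases ha : a.toAdd = 0
        · rw [ha, zero_add, if_pos rfl, one_mul]
        · rw [if_neg ha, if_neg (fun h => ha (hG _ _ h)), zero_mul] }

theorem constCoeff_apply (hG : ∀ a b : G, a + b = 0 → a = 0) (u : AddMonoidAlgebra A G) :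
    constCoeff A hG u = u.coeff 0 := by
  classical
  rw [constCoeff, AddMonoidAlgebra.lift_apply, Finsupp.sum]
  simp only [MonoidHom.coe_mk, OneHom.coe_mk, toAdd_ofAdd, smul_eq_mul, mul_ite, mul_one, mul_zero]
  rw [Finset.sum_ite_eq']
  split_ifs with h
  · rfl
  · exact (Finsupp.notMem_support_iff.1 h).symm

variable {A}

/-- An idempotent without constant term vanishes: its terms of least weight cannot occur in its
square. -/
theorem eq_zero_of_isIdempotent {w : G →+ ℕ} (hw : ∀ g, w g = 0 → g = 0)
    {e : AddMonoidAlgebra A G} (he : e * e = e) (h0 : e.coeff 0 = 0) : e = 0 := by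
  classical
  by_contra hne
  have hsupp : e.coeff.support.Nonempty :=
    Finsupp.support_nonempty_iff.2 fun h => hne (AddMonoidAlgebra.ext h)
  obtain ⟨p, hp, hmin⟩ := e.coeff.support.exists_min_image w hsupp
  have hp' : p ∈ (e * e).coeff.support := by rwa [he]
  obtain ⟨q, hq, r, hr, rfl⟩ := Finset.mem_add.1 (AddMonoidAlgebra.support_coeff_mul_subset e e hp')
  have h1 := hmin q hq
  have h2 := hmin r hr
  rw [map_add] at h1 h2
  rw [hw _ (by rw [map_add]; omega : w (q + r) = 0)] at hp
  exact Finsupp.mem_support_iff.1 hp h0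

theorem eq_zero_of_add_eq_zero {w : G →+ ℕ} (hw : ∀ g, w g = 0 → g = 0) (a b : G)
    (h : a + b = 0) : a = 0 :=
  hw a (by have := congrArg w h; rw [map_add, map_zero] at this; omega)

/-- The algebra of a positively graded monoid over a connected ring is connected. -/
theorem isConnected_of_weight (hconn : ∀ e : A, e * (1 - e) = 0 → e = 0 ∨ e = 1) {w : G →+ ℕ}
    (hw : ∀ g, w g = 0 → g = 0) (e : AddMonoidAlgebra A G) (he : e * (1 - e) = 0) :
    e = 0 ∨ e = 1 := by
  have hG := eq_zero_of_add_eq_zero hw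
  have h := congrArg (constCoeff A hG) he
  rw [map_mul, map_sub, map_one, map_zero] at h
  rcases hconn _ h with h | h
  · left
    exact eq_zero_of_isIdempotent hw (by linear_combination -he) (by rwa [← constCoeff_apply A hG])
  · right
    have : 1 - e = 0 := eq_zero_of_isIdempotent hw (by linear_combination -he) (by
      rw [← constCoeff_apply A hG, map_sub, map_one, h, sub_self])
    exact (sub_eq_zero.1 this).symm

end PositiveGrading

/-! ### Coordinate rings of the charts -/

section Charts

variable {n : ℕ}

theorem eq_zero_of_mem_expts {i : Fin (n + 1)} {p : degZero n} (hp : p ∈ expts {i})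
    (h : 0 ≤ p.1 i) : p = 0 := by
  have hnn : ∀ l ∈ Finset.univ, 0 ≤ p.1 l := fun l _ => by
    by_cases hl : l = i
    · rwa [hl]
    · exact hp l (by simpa using hl)
  ext l
  exact (Finset.sum_eq_zero_iff_of_nonneg hnn).1 p.2 l (Finset.mem_univ l)

theorem apply_nonpos_of_mem_expts {i : Fin (n + 1)} {p : degZero n} (hp : p ∈ expts {i}) :
    p.1 i ≤ 0 := by
  by_contra h
  rw [eq_zero_of_mem_expts hp (by omega)] at h
  exact h le_rfl

theorem baseExpts_le (i j : Fin (n + 1)) {p : degZero n} (hp : p ∈ baseExpts i j) :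
    p ∈ expts {j} := fun l hl => by
  by_cases h : l = i
  · rw [h, hp.2]
  · exact hp.1 l (by simpa [h] using hl)

theorem zsmul_ratioExp_mem_expts {i j : Fin (n + 1)} {k : ℤ} (hk : k ≤ 0) :
    k • ratioExp i j ∈ expts {j} := fun l hl => by
  rw [zsmul_ratioExp_apply, if_neg (by simpa using hl)]
  split_ifs <;> omega

/-- The grading of the exponents of the chart `j` by minus the exponent of `X_j`. -/
def weight (j : Fin (n + 1)) : expts ({j} : Set (Fin (n + 1))) →+ ℕ where
  toFun p := (-p.1.1 j).toNat
  map_zero' := rfl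
  map_add' p q := by
    have hp := apply_nonpos_of_mem_expts p.2
    have hq := apply_nonpos_of_mem_expts q.2
    change (-(p.1.1 j + q.1.1 j)).toNat = (-p.1.1 j).toNat + (-q.1.1 j).toNat
    omega

theorem eq_zero_of_weight {j : Fin (n + 1)} (p : expts ({j} : Set (Fin (n + 1))))
    (h : weight j p = 0) : p = 0 := by
  refine Subtype.ext (eq_zero_of_mem_expts p.2 ?_)
  change (-p.1.1 j).toNat = 0 at h
  omega

variable {A : Type*} [CommRing A]

theorem isConnected_baseExpts (hconn : ∀ e : A, e * (1 - e) = 0 → e = 0 ∨ e = 1)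
    (i j : Fin (n + 1)) (e : AddMonoidAlgebra A (baseExpts i j)) (he : e * (1 - e) = 0) :
    e = 0 ∨ e = 1 :=
  isConnected_of_weight hconn
    (w := (weight j).comp (AddSubmonoid.inclusion fun _ => baseExpts_le i j))
    (fun _ hg => Subtype.ext (congrArg (fun p => p.1) (eq_zero_of_weight _ hg))) e he

variable (A) in
/-- Evaluation of functions on the chart `i` at the point where all `X_l` with `l ≠ i` vanish. -/
noncomputable def evalPoint (i : Fin (n + 1)) : T₁ A i →+* A :=
  (constCoeff A (eq_zero_of_add_eq_zero (eq_zero_of_weight (j := i)))).toRingHom.comp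
    (monoidAlgebraEquivTS A {i}).symm.toRingHom

theorem evalPoint_apply {i : Fin (n + 1)} (u : T₁ A i) : evalPoint A i u = u.1.coeff 0 := by
  obtain ⟨v, rfl⟩ := (monoidAlgebraEquivTS A {i}).surjective u
  refine Eq.trans ?_ (coeff_monoidAlgebraEquivTS A v 0).symm
  change constCoeff A (eq_zero_of_add_eq_zero (eq_zero_of_weight (j := i)))
    ((monoidAlgebraEquivTS A {i}).symm (monoidAlgebraEquivTS A {i} v)) = _
  rw [RingEquiv.symm_apply_apply, constCoeff_apply]

open LaurentLine

theorem laurentEquiv_mem_nonneg_iff {i j : Fin (n + 1)} (hij : i ≠ j) (u : T₂ A i j) :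
    laurentEquiv A hij u ∈ nonneg _ ↔ ∀ p, u.1.coeff p ≠ 0 → p.1 i ≤ 0 := by
  rw [mem_nonneg_iff]
  constructor
  · intro h p hp
    by_contra hlt
    let q := exptsEquiv hij ⟨p, mem_TS.1 u.2 p hp⟩
    have hq : q.2.1 + q.1 • ratioExp i j = p :=
      congrArg Subtype.val ((exptsEquiv hij).symm_apply_apply ⟨p, mem_TS.1 u.2 p hp⟩)
    have := coeff_laurentEquiv A hij u q.1 q.2
    rw [hq, h q.1 (by change -p.1 i < 0; omega)] at this
    exact hp this.symm
  · intro h k hk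
    ext g
    rw [coeff_laurentEquiv]
    by_contra hne
    have := h _ hne
    rw [AddSubgroup.coe_add, Pi.add_apply, g.2.2, zsmul_ratioExp_apply, if_neg hij,
      if_pos rfl] at this
    omega

theorem laurentEquiv_mem_nonneg {i j : Fin (n + 1)} (hij : i ≠ j) {u : T₂ A i j}
    (hu : u.1 ∈ TS A {i}) : laurentEquiv A hij u ∈ nonneg _ :=
  (laurentEquiv_mem_nonneg_iff hij u).2 fun p hp => apply_nonpos_of_mem_expts (mem_TS.1 hu p hp)

theorem laurentEquiv_mem_nonpos_iff {i j : Fin (n + 1)} (hij : i ≠ j) (u : T₂ A i j) :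
    laurentEquiv A hij u ∈ nonpos _ ↔ u.1 ∈ TS A {j} := by
  rw [mem_nonpos_iff, mem_TS]
  constructor
  · intro h p hp
    let q := exptsEquiv hij ⟨p, mem_TS.1 u.2 p hp⟩
    have hq : q.2.1 + q.1 • ratioExp i j = p :=
      congrArg Subtype.val ((exptsEquiv hij).symm_apply_apply ⟨p, mem_TS.1 u.2 p hp⟩)
    rw [← hq]
    refine add_mem (baseExpts_le i j q.2.2) (zsmul_ratioExp_mem_expts ?_)
    by_contra hlt
    have := coeff_laurentEquiv A hij u q.1 q.2
    rw [hq, h q.1 (by omega)] at this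
    exact hp this.symm
  · intro h k hk
    ext g
    rw [coeff_laurentEquiv]
    by_contra hne
    have := h _ hne i (by simpa using hij)
    rw [AddSubgroup.coe_add, Pi.add_apply, g.2.2, zsmul_ratioExp_apply, if_neg hij,
      if_pos rfl] at this
    omega

theorem coeff_zero_laurentEquiv {i j : Fin (n + 1)} (hij : i ≠ j) {u : T₂ A i j}
    (hu : u.1 ∈ TS A {i}) (h1 : u.1.coeff 0 = 1) : (laurentEquiv A hij u).coeff 0 = 1 := by
  classical
  ext g
  rw [coeff_laurentEquiv, zero_smul, add_zero]
  by_cases hg : g = 0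
  · rw [hg]
    simpa using h1
  · have hne : u.1.coeff g.1 = 0 := by
      by_contra hne
      exact hg (Subtype.ext (eq_zero_of_mem_expts (mem_TS.1 hu _ hne) g.2.2.ge))
    rw [hne, AddMonoidAlgebra.one_def, AddMonoidAlgebra.coeff_single, Finsupp.single_apply,
      if_neg (Ne.symm hg)]

theorem coe_ratio_zpow (i j : Fin (n + 1)) (d : ℤ) :
    ((ratio A i j ^ d : (T₂ A i j)ˣ) : T₂ A i j).1 =
      AddMonoidAlgebra.single (d • ratioExp i j) 1 := by
  have hr : (ratio A i j : T₂ A i j).1 = AddMonoidAlgebra.single (ratioExp i j) 1 := rfl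
  have hr' : ((ratio A i j)⁻¹ : (T₂ A i j)ˣ).1.1 =
      AddMonoidAlgebra.single (-ratioExp i j) 1 := by
    rw [neg_eq_of_add_eq_zero_right (ratioExp_add i j)]
    rfl
  induction d using Int.induction_on with
  | zero => rw [zpow_zero, zero_smul]; rfl
  | succ d hd =>
    rw [zpow_add_one, Units.val_mul, MulMemClass.coe_mul, hd, hr,
      AddMonoidAlgebra.single_mul_single, one_mul, add_smul, one_smul]
  | pred d hd =>
    rw [zpow_sub_one, Units.val_mul, MulMemClass.coe_mul, hd, hr',
      AddMonoidAlgebra.single_mul_single, one_mul, sub_smul, one_smul, sub_eq_add_neg]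

theorem laurentEquiv_ratio_zpow {i j : Fin (n + 1)} (hij : i ≠ j) (d : ℤ) :
    laurentEquiv A hij (ratio A i j ^ d : (T₂ A i j)ˣ) = LaurentPolynomial.T d := by
  classical
  ext k g
  rw [coeff_laurentEquiv, coe_ratio_zpow, AddMonoidAlgebra.coeff_single, Finsupp.single_apply,
    LaurentPolynomial.T_apply]
  have hk : d • ratioExp i j = g.1 + k • ratioExp i j ↔ d = k ∧ g = 0 := by
    constructor
    · intro h
      have hi := congrArg (fun p => p.1 i) h
      simp only [AddSubgroup.coe_add, Pi.add_apply, g.2.2, zsmul_ratioExp_apply, if_neg hij,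
        if_true] at hi
      obtain rfl : d = k := by omega
      exact ⟨rfl, Subtype.ext (by simpa using h)⟩
    · rintro ⟨rfl, rfl⟩
      simp
  simp only [hk]
  by_cases hd : d = k
  · by_cases hg : g = 0
    · simp [hd, hg]
    · simp [hd, hg, AddMonoidAlgebra.one_def]
  · simp [hd]

end Charts

/-! ### Invertible sheaves on the union of two charts -/

set_option maxHeartbeats 1600000 in
open LaurentLine in
/-- Let `B` be the ring of polynomials in the `X_l / X_j`, `l ≠ i, j`, and `T = X_j / X_i`. Then
`T_j(A) = B[T⁻¹]` and `T_{ij}(A) = B[T;T⁻¹]`, while `T_i(A)` is a proper subring of `B[T]` in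
general, which is an affine piece of the blow-up of the chart `i` in the point where all other
coordinates vanish. Thus an invertible sheaf on the union of the charts `i` and `j` pulls back to
one on the projective line over `B`; it is a twist `𝒪(-d)` there, since it is trivial at `T = 0`,
the exceptional divisor. Here `E` is the module of sections on the overlap, `x`, `x'` and `y`, `y'`
generate the sections and the dual sections on the charts `i` and `j`, and `z`, `z'` witness the
triviality. -/
theorem exists_trivialization {A : Type*} [CommRing A]
    (hconn : ∀ e : A, e * (1 - e) = 0 → e = 0 ∨ e = 1) {n : ℕ} {i j : Fin (n + 1)} (hij : i ≠ j)
    {E : Type*} [AddCommGroup E] [Module (T₂ A i j) E] [Module.Invertible (T₂ A i j) E]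
    {ι κ : Type*} [Fintype ι] [Fintype κ] (x : ι → E) (x' : ι → Module.Dual (T₂ A i j) E)
    (y : κ → E) (y' : κ → Module.Dual (T₂ A i j) E) (z : E) (z' : Module.Dual (T₂ A i j) E)
    (hx : ∀ a c, (x' c (x a)).1 ∈ TS A {i}) (hx1 : ∑ a, x' a (x a) = 1)
    (hy : ∀ a c, (y' c (y a)).1 ∈ TS A {j}) (hy1 : ∑ a, y' a (y a) = 1)
    (hz : ∀ c, (x' c z).1 ∈ TS A {i}) (hz' : ∀ a, (z' (x a)).1 ∈ TS A {i})
    (hzz : (z' z).1 ∈ TS A {i}) (hzz1 : (z' z).1.coeff 0 = 1) :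
    ∃ (d : ℤ) (s : E) (s' : Module.Dual (T₂ A i j) E), s' s = 1 ∧
      (∀ c, laurentEquiv A hij (x' c s) ∈ nonneg _) ∧
      (∀ a, laurentEquiv A hij (s' (x a)) ∈ nonneg _) ∧
      (∀ c, (((ratio A i j ^ d : (T₂ A i j)ˣ) : T₂ A i j) * y' c s).1 ∈ TS A {j}) ∧
      (∀ a, (((ratio A i j ^ (-d) : (T₂ A i j)ˣ) : T₂ A i j) * s' (y a)).1 ∈ TS A {j}) ∧
      (laurentEquiv A hij (z' s)).coeff 0 = 1 := by
  let B := AddMonoidAlgebra A (baseExpts i j)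
  let R := LaurentPolynomial B
  let φ : T₂ A i j ≃+* R := laurentEquiv A hij
  let E' := Module.Dual (T₂ A i j) E
  let : Module R E := Module.compHom E φ.symm.toRingHom
  let : Module R E' := Module.compHom E' φ.symm.toRingHom
  let : Module B E := Module.compHom E (LaurentPolynomial.C : B →+* R)
  let : Module B E' := Module.compHom E' (LaurentPolynomial.C : B →+* R)
  have : IsScalarTower B R E := ⟨fun b r v => by
    rw [LaurentPolynomial.smul_eq_C_mul, mul_smul]; rfl⟩
  have : IsScalarTower B R E' := ⟨fun b r v => by
    rw [LaurentPolynomial.smul_eq_C_mul, mul_smul]; rfl⟩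
  have hE : ∀ (r : R) (v : E), r • v = φ.symm r • v := fun _ _ => rfl
  have hE' : ∀ (r : R) (v : E'), r • v = φ.symm r • v := fun _ _ => rfl
  have hxsum : ∑ a, φ (x' a (x a)) = 1 := by rw [← map_sum φ, hx1, map_one]
  have hysum : ∑ a, φ (y' a (y a)) = 1 := by rw [← map_sum φ, hy1, map_one]
  let L : Glued B E E' ι κ :=
    { pair := LinearMap.mk₂ R (fun v f => φ (f v))
        (fun v w f => by rw [map_add, map_add])
        (fun r v f => by rw [hE, map_smul, smul_eq_mul, map_mul, φ.apply_symm_apply, smul_eq_mul])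
        (fun v f g => by rw [LinearMap.add_apply, map_add])
        (fun r v f => by
          rw [hE', LinearMap.smul_apply, smul_eq_mul, map_mul, φ.apply_symm_apply, smul_eq_mul])
      exchange := fun v f w => by
        simp only [LinearMap.mk₂_apply, hE, φ.symm_apply_apply]
        exact dual_exchange f v w
      exchange' := fun v f g => by
        simp only [LinearMap.mk₂_apply, hE', φ.symm_apply_apply]
        exact dual_exchange' f g v
      x := x
      x' := x'
      y := y
      y' := y'
      x_mem := fun a c => laurentEquiv_mem_nonneg hij (hx a c)
      x_sum := hxsum
      y_mem := fun a c => (laurentEquiv_mem_nonpos_iff hij _).2 (hy a c)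
      y_sum := hysum }
  obtain ⟨d, s, hs, s', hs', hss, hsz⟩ := L.exists_trivialization (z := z) (z' := z')
    (isConnected_baseExpts hconn i j)
    (fun c => laurentEquiv_mem_nonneg hij (hz c)) (fun a => laurentEquiv_mem_nonneg hij (hz' a))
    (coeff_zero_laurentEquiv hij hzz hzz1)
  refine ⟨d, s, s', φ.injective (hss.trans (map_one φ).symm), hs.1, hs'.1, fun c => ?_,
    fun a => ?_, hsz⟩
  · rw [← laurentEquiv_mem_nonpos_iff hij, map_mul, laurentEquiv_ratio_zpow]
    exact hs.2 c
  · rw [← laurentEquiv_mem_nonpos_iff hij, map_mul, laurentEquiv_ratio_zpow]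
    exact hs'.2 a

/-! ### Cocycles of units -/

section Units

variable {A : Type*} [CommRing A] {n : ℕ}

/-- The elements of `T(A)` all of whose monomials have a negative exponent of `X_i`. -/
def negPart (A : Type*) [CommRing A] {n : ℕ} (i : Fin (n + 1)) : NonUnitalSubring (T A n) where
  carrier := {u | ∀ p, u.coeff p ≠ 0 → p.1 i < 0}
  zero_mem' p hp := absurd rfl hp
  add_mem' {u v} hu hv p hp := by
    by_contra h
    refine hp ?_
    rw [AddMonoidAlgebra.coeff_add, Finsupp.add_apply, not_not.1 (mt (hu p) h),
      not_not.1 (mt (hv p) h), add_zero]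
  neg_mem' {u} hu p hp := hu p fun h => hp (by
    rw [AddMonoidAlgebra.coeff_neg, Finsupp.neg_apply, h, neg_zero])
  mul_mem' {u v} hu hv p hp := by
    classical
    obtain ⟨q, hq, r, hr, rfl⟩ := Finset.mem_add.1
      (AddMonoidAlgebra.support_coeff_mul_subset u v (Finsupp.mem_support_iff.2 hp))
    have h1 := hu q (Finsupp.mem_support_iff.1 hq)
    have h2 := hv r (Finsupp.mem_support_iff.1 hr)
    rw [AddSubgroup.coe_add, Pi.add_apply]
    omega

theorem mem_negPart {i : Fin (n + 1)} {u : T A n} :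
    u ∈ negPart A i ↔ ∀ p, u.coeff p ≠ 0 → p.1 i < 0 := Iff.rfl

/-- The monomial `X^p`. -/
noncomputable abbrev monom (A : Type*) [CommRing A] {n : ℕ} (p : degZero n) : T A n :=
  AddMonoidAlgebra.single p 1

theorem monom_mul_monom (p q : degZero n) : monom A p * monom A q = monom A (p + q) := by
  rw [AddMonoidAlgebra.single_mul_single, one_mul]

open LaurentLine in
theorem sub_one_mem_negPart {i j : Fin (n + 1)} (hij : i ≠ j) {b : T₂ A i j}
    (hb : laurentEquiv A hij b ∈ nonneg _) (hb0 : (laurentEquiv A hij b).coeff 0 = 1) :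
    b.1 - 1 ∈ negPart A i := fun p hp => by
  classical
  rw [AddMonoidAlgebra.coeff_sub, Finsupp.sub_apply, AddMonoidAlgebra.one_def,
    AddMonoidAlgebra.coeff_single, Finsupp.single_apply] at hp
  by_cases hp0 : b.1.coeff p = 0
  · rw [hp0] at hp
    split_ifs at hp with h
    · have h2 := congrArg (fun f => f.coeff 0) hb0
      simp only [coeff_laurentEquiv] at h2
      rw [ZeroMemClass.coe_zero, zero_smul, add_zero, h, hp0, AddMonoidAlgebra.one_def,
        AddMonoidAlgebra.coeff_single, Finsupp.single_eq_same] at h2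
      exact absurd (by rw [← h2, sub_zero]) hp
    · simp at hp
  · have hle := (laurentEquiv_mem_nonneg_iff hij b).1 hb p hp0
    refine lt_of_le_of_ne hle fun hpi => ?_
    have h2 := congrArg (fun f => f.coeff ⟨p, mem_TS.1 b.2 p hp0, hpi⟩) hb0
    simp only [coeff_laurentEquiv] at h2
    rw [zero_smul, add_zero] at h2
    refine hp ?_
    rw [h2, AddMonoidAlgebra.one_def, AddMonoidAlgebra.coeff_single, Finsupp.single_apply]
    simp [Subtype.ext_iff, sub_self]

open LaurentLine in
/-- A unit of `T_{ij}(A)` is the product of a power of `X_j / X_i`, a unit `a` of `T_j(A)`, and a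
unit `b` that, like its inverse, differs from `1` by monomials with a negative exponent of `X_i`. -/
theorem exists_unit_factorization (hconn : ∀ e : A, e * (1 - e) = 0 → e = 0 ∨ e = 1)
    {i j : Fin (n + 1)} (hij : i ≠ j) {u v : T A n} (hu : u ∈ TS A {i, j}) (hv : v ∈ TS A {i, j})
    (huv : u * v = 1) :
    ∃ (d : ℤ) (a a' b b' : T A n), a ∈ TS A {j} ∧ a' ∈ TS A {j} ∧ b ∈ TS A {i, j} ∧
      b' ∈ TS A {i, j} ∧ a * a' = 1 ∧ b * b' = 1 ∧ b - 1 ∈ negPart A i ∧ b' - 1 ∈ negPart A i ∧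
      u = monom A (d • ratioExp i j) * a * b := by
  let U : T₂ A i j := ⟨u, hu⟩
  let V : T₂ A i j := ⟨v, hv⟩
  have hUV : U * V = 1 := Subtype.ext huv
  have hone : (1 : T₂ A i j).1 = (1 : T A n) := rfl
  have hone0 : (1 : T₂ A i j).1.coeff 0 = 1 := by
    rw [hone, AddMonoidAlgebra.one_def, AddMonoidAlgebra.coeff_single, Finsupp.single_eq_same]
  obtain ⟨d, s, s', hss, hs, hs', ha, ha', hs1⟩ := exists_trivialization hconn hij
    (E := T₂ A i j) (fun _ : Unit => 1) (fun _ : Unit => LinearMap.id) (fun _ : Unit => V)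
    (fun _ : Unit => U • LinearMap.id) 1 LinearMap.id (fun _ _ => one_mem _) (by simp)
    (fun _ _ => by
      rw [LinearMap.smul_apply, LinearMap.id_apply, smul_eq_mul, hUV]; exact one_mem _)
    (by simpa using hUV) (fun _ => one_mem _) (fun _ => one_mem _) (one_mem _) hone0
  have hs := hs ()
  have hs' := hs' ()
  have ha := ha ()
  have ha' := ha' ()
  simp only [LinearMap.id_apply, LinearMap.smul_apply, smul_eq_mul] at hs ha hs1
  have hsV : s' V = V * s' 1 := by
    conv_lhs => rw [← mul_one V, ← smul_eq_mul, map_smul, smul_eq_mul]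
  have hs'1 : s' 1 * s = 1 := by
    rw [mul_comm, ← smul_eq_mul, ← map_smul, smul_eq_mul, mul_one, hss]
  rw [hsV] at ha'
  have hs'0 : (laurentEquiv A hij (s' 1)).coeff 0 = 1 := by
    have := congrArg (fun f => (laurentEquiv A hij f).coeff 0) hs'1
    simp only [map_mul, map_one] at this
    rw [coeff_zero_mul hs' hs, hs1, mul_one] at this
    rw [this, AddMonoidAlgebra.one_def, AddMonoidAlgebra.coeff_single, Finsupp.single_eq_same]
  have hss1 : (s' 1).1 * s.1 = 1 := congrArg Subtype.val hs'1
  have hX : monom A (d • ratioExp i j) * monom A (-d • ratioExp i j) = 1 := by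
    rw [monom_mul_monom, neg_smul, add_neg_cancel]; rfl
  rw [MulMemClass.coe_mul, coe_ratio_zpow] at ha ha'
  refine ⟨-d, _, _, (s' 1).1, s.1, ha, ha', (s' 1).2, s.2, ?_, hss1,
    sub_one_mem_negPart hij hs' hs'0, sub_one_mem_negPart hij hs hs1, ?_⟩
  · change monom A (d • ratioExp i j) * (u * s.1) * (monom A (-d • ratioExp i j) * (v * (s' 1).1))
      = 1
    linear_combination (u * v * s.1 * (s' 1).1) * hX + (u * v) * hss1 + huv
  · change u = monom A (-d • ratioExp i j) * (monom A (d • ratioExp i j) * (u * s.1)) * (s' 1).1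
    linear_combination (-u * s.1 * (s' 1).1) * hX - u * hss1

theorem coeff_monom_mul (q p : degZero n) (w : T A n) :
    (monom A q * w).coeff p = w.coeff (p - q) := by
  rw [mul_comm, AddMonoidAlgebra.coeff_mul_single_eq_coeff_mul (p - q)
    (fun r _ => ⟨fun h => eq_sub_of_add_eq h, fun h => by rw [h, sub_add_cancel]⟩), mul_one]

/-- The constant `1` is the leading term of `1 + c` with respect to the exponent of `X_i`, so it
cannot be missing from `X^q w`; if `q` does not involve `X_i`, nothing else can occur there. -/
theorem leading_term_comparison [Nontrivial A] {i : Fin (n + 1)} {w c : T A n} {q : degZero n}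
    (hw : ∀ p, w.coeff p ≠ 0 → 0 ≤ p.1 i) (hc : c ∈ negPart A i) (h : 1 + c = monom A q * w) :
    q.1 i ≤ 0 ∧ (q.1 i = 0 → c = 0) := by
  classical
  have key : ∀ p, (1 : T A n).coeff p + c.coeff p = w.coeff (p - q) := fun p => by
    rw [← coeff_monom_mul, ← h, AddMonoidAlgebra.coeff_add, Finsupp.add_apply]
  have hc0 : ∀ p : degZero n, 0 ≤ p.1 i → c.coeff p = 0 := fun p hp => by
    by_contra hne
    exact absurd (mem_negPart.1 hc p hne) (not_lt.2 hp)
  have hone : ∀ p : degZero n, (1 : T A n).coeff p = if 0 = p then 1 else 0 := fun p => by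
    rw [AddMonoidAlgebra.one_def, AddMonoidAlgebra.coeff_single, Finsupp.single_apply]
  constructor
  · have h0 := key 0
    rw [hone, if_pos rfl, hc0 0 le_rfl, add_zero] at h0
    have := hw (0 - q) (by rw [← h0]; exact one_ne_zero)
    rw [zero_sub, AddSubgroup.coe_neg, Pi.neg_apply] at this
    omega
  · intro hq
    ext p
    by_contra hne
    have hp : p.1 i < 0 := mem_negPart.1 hc p hne
    have h1 := key p
    rw [hone, if_neg (by rintro rfl; exact lt_irrefl 0 hp), zero_add] at h1
    have := hw (p - q) (by rw [← h1]; exact hne)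
    rw [AddSubgroup.coe_sub, Pi.sub_apply] at this
    omega

theorem ratioExp_add_ratioExp (i j k : Fin (n + 1)) :
    ratioExp i j + ratioExp j k = ratioExp i k := by
  apply Subtype.ext
  simp [ratioExp]

/-- In the factorizations of the transition functions between a chart `i` and two further charts,
the degrees agree, and so do the factors that are not defined on these further charts. Indeed the
quotient of the latter is, up to a monomial, a function on the intersection of the further charts,
on which `X_i` occurs with nonnegative exponents only, and so is its inverse: compare leading
terms. -/
theorem factorization_unique [Nontrivial A] {i j k : Fin (n + 1)} (hij : i ≠ j) (hik : i ≠ k)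
    {uij uik ujk ukj a a' b b' c c' e e' : T A n} {d₁ d₂ : ℤ} (hjk : ujk ∈ TS A {j, k})
    (hkj : ukj ∈ TS A {k, j}) (h1 : uij * ujk = uik) (h2 : uik * ukj = uij)
    (ha : a ∈ TS A {j}) (ha' : a' ∈ TS A {j}) (hc : c ∈ TS A {k}) (hc' : c' ∈ TS A {k})
    (haa : a * a' = 1) (hbb : b * b' = 1) (hcc : c * c' = 1) (hee : e * e' = 1)
    (hb : b - 1 ∈ negPart A i) (hb' : b' - 1 ∈ negPart A i) (he : e - 1 ∈ negPart A i)
    (he' : e' - 1 ∈ negPart A i) (hu : uij = monom A (d₁ • ratioExp i j) * a * b)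
    (hv : uik = monom A (d₂ • ratioExp i k) * c * e) : d₁ = d₂ ∧ b = e := by
  have hprod : ∀ {f g : T A n}, f - 1 ∈ negPart A i → g - 1 ∈ negPart A i →
      f * g - 1 ∈ negPart A i := fun {f g} hf hg => by
    have := add_mem (add_mem (mul_mem hf hg) hf) hg
    convert this using 1
    ring
  have hnn : ∀ {j k : Fin (n + 1)} {f : T A n}, i ≠ j → i ≠ k → f ∈ TS A {j, k} →
      ∀ p, f.coeff p ≠ 0 → 0 ≤ p.1 i := fun {j k f} hj hk hf p hp =>
    mem_TS.1 hf p hp i (by simp [hj, hk])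
  have hm : ∀ (d : ℤ) (l : Fin (n + 1)),
      monom A (-(d • ratioExp i l)) * monom A (d • ratioExp i l) = 1 := fun d l => by
    rw [monom_mul_monom, neg_add_cancel]; rfl
  have sub_j : TS A {j} ≤ TS A {j, k} := TS_mono A (by simp)
  have sub_k : TS A {k} ≤ TS A {j, k} := TS_mono A (by simp)
  have sub_j' : TS A {j} ≤ TS A {k, j} := TS_mono A (by simp)
  have sub_k' : TS A {k} ≤ TS A {k, j} := TS_mono A (by simp)
  have e1 : 1 + (e * b' - 1) =
      monom A (-(d₂ • ratioExp i k) + d₁ • ratioExp i j) * (ujk * a * c') := by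
    rw [← monom_mul_monom]
    rw [hu, hv] at h1
    have h3 := hm d₂ k
    linear_combination (-c' * b' * monom A (-(d₂ • ratioExp i k))) * h1
      - c * c' * e * b' * h3 - e * b' * hcc +
      monom A (-(d₂ • ratioExp i k)) * monom A (d₁ • ratioExp i j) * ujk * a * c' * hbb
  have e2 : 1 + (b * e' - 1) =
      monom A (-(d₁ • ratioExp i j) + d₂ • ratioExp i k) * (ukj * c * a') := by
    rw [← monom_mul_monom]
    rw [hu, hv] at h2
    have h3 := hm d₁ j
    linear_combination (-a' * e' * monom A (-(d₁ • ratioExp i j))) * h2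
      - a * a' * b * e' * h3 - b * e' * haa +
      monom A (-(d₁ • ratioExp i j)) * monom A (d₂ • ratioExp i k) * ukj * c * a' * hee
  obtain ⟨l1, l1'⟩ := leading_term_comparison
    (hnn hij hik (mul_mem (mul_mem hjk (sub_j ha)) (sub_k hc'))) (hprod he hb') e1
  obtain ⟨l2, -⟩ := leading_term_comparison
    (hnn hik hij (mul_mem (mul_mem hkj (sub_k' hc)) (sub_j' ha'))) (hprod hb he') e2
  simp only [AddSubgroup.coe_add, AddSubgroup.coe_neg, Pi.add_apply, Pi.neg_apply,
    zsmul_ratioExp_apply, if_neg hij, if_neg hik, if_true] at l1 l1' l2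
  obtain rfl : d₁ = d₂ := by omega
  have h4 := l1' (by omega)
  exact ⟨rfl, by linear_combination (-b) * h4 + e * hbb⟩

/-- A cocycle of units on the standard covering of projective space is, up to a coboundary, a power
of the cocycle `X_j / X_i`. The factor `a` in the factorization of `u 0 j` provides the unit on the
chart `j`, the factor `b`, which does not depend on `j`, the inverse of the one on the chart `0`. -/
theorem cocycle_eq (hconn : ∀ e : A, e * (1 - e) = 0 → e = 0 ∨ e = 1)
    (u : Fin (n + 1) → Fin (n + 1) → T A n) (hu : ∀ i j, u i j ∈ TS A {i, j})
    (hself : ∀ i, u i i = 1) (hcoc : ∀ i j k, u i j * u j k = u i k) :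
    ∃ (d : ℤ) (s : ∀ i : Fin (n + 1), (T₁ A i)ˣ), ∀ i j,
      u i j = monom A (d • ratioExp i j) * (s j : T₁ A j).1 * ((s i)⁻¹ : (T₁ A i)ˣ).1.1 := by
  rcases subsingleton_or_nontrivial A with hA | hA
  · have : Subsingleton (T A n) := ⟨fun f g => by ext p; exact Subsingleton.elim _ _⟩
    exact ⟨0, fun _ => 1, fun _ _ => Subsingleton.elim _ _⟩
  -- it suffices to treat the transition functions from one chart
  suffices h : ∃ (d : ℤ) (s : ∀ i : Fin (n + 1), (T₁ A i)ˣ), ∀ j,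
      u 0 j = monom A (d • ratioExp 0 j) * (s j : T₁ A j).1 * ((s 0)⁻¹ : (T₁ A 0)ˣ).1.1 by
    obtain ⟨d, s, hs⟩ := h
    refine ⟨d, s, fun i j => ?_⟩
    have h0 : (s 0 : T₁ A 0).1 * ((s 0)⁻¹ : (T₁ A 0)ˣ).1.1 = 1 :=
      congrArg Subtype.val (s 0).mul_inv
    have hi : (s i : T₁ A i).1 * ((s i)⁻¹ : (T₁ A i)ˣ).1.1 = 1 :=
      congrArg Subtype.val (s i).mul_inv
    have hm : monom A (d • ratioExp i 0) * monom A (d • ratioExp 0 j) =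
        monom A (d • ratioExp i j) := by
      rw [monom_mul_monom, ← smul_add, ratioExp_add_ratioExp]
    have hm' : monom A (d • ratioExp i 0) * monom A (d • ratioExp 0 i) = 1 := by
      rw [monom_mul_monom, ← smul_add, ratioExp_add, smul_zero]; rfl
    have h1 := hcoc 0 i j
    rw [hs i, hs j] at h1
    set S0 := (s 0).1.1
    set S0' := (s 0)⁻¹.1.1
    set Si := (s i : T₁ A i).1
    set Si' := ((s i)⁻¹ : (T₁ A i)ˣ).1.1
    set Sj := (s j : T₁ A j).1
    have h2 : monom A (d • ratioExp i 0) * monom A (d • ratioExp 0 i) * (Si * Si') * (S0 * S0') *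
        u i j = monom A (d • ratioExp i 0) * monom A (d • ratioExp 0 j) * Sj * Si' *
          (S0 * S0') := by
      linear_combination (monom A (d • ratioExp i 0) * Si' * S0) * h1
    rw [hm, hm', hi, h0] at h2
    linear_combination h2
  by_cases hn : ∃ j₀ : Fin (n + 1), 0 ≠ j₀
  swap
  · push Not at hn
    refine ⟨0, fun _ => 1, fun j => ?_⟩
    obtain rfl := hn j
    rw [hself, zero_smul, inv_one]
    change (1 : T A n) = 1 * 1 * 1
    rw [mul_one, mul_one]
  obtain ⟨j₀, hj₀⟩ := hn
  have hinv : ∀ i j, u i j * u j i = 1 := fun i j => by rw [hcoc, hself]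
  have hu' : ∀ i j, u i j ∈ TS A {j, i} := fun i j => Set.pair_comm i j ▸ hu i j
  choose d a a' b b' ha ha' hb hb' haa hbb hb1 hb1' hfac using
    fun (j : Fin (n + 1)) (hj : 0 ≠ j) =>
      exists_unit_factorization hconn hj (hu 0 j) (hu' j 0) (hinv 0 j)
  have huniq : ∀ j (hj : 0 ≠ j), d j₀ hj₀ = d j hj ∧ b j₀ hj₀ = b j hj := fun j hj =>
    factorization_unique hj₀ hj (hu j₀ j) (hu j j₀) (hcoc 0 j₀ j) (hcoc 0 j j₀)
      (ha _ _) (ha' _ _) (ha _ _) (ha' _ _) (haa _ _) (hbb _ _) (haa _ _) (hbb _ _)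
      (hb1 _ _) (hb1' _ _) (hb1 _ _) (hb1' _ _) (hfac _ _) (hfac _ _)
  have huniq' : ∀ j (hj : 0 ≠ j), b' j₀ hj₀ = b' j hj := fun j hj => by
    have h1 := hbb j₀ hj₀
    have h2 := hbb j hj
    rw [← (huniq j hj).2] at h2
    linear_combination b' j hj * h1 - b' j₀ hj₀ * h2
  -- `b` is a function on the chart `0`, since it is one on all its intersections with other charts;
  -- if there is only one other chart, the sign of the exponent of `X_0` is needed as well
  have hmem : ∀ f : T A n, (∀ j, 0 ≠ j → f ∈ TS A {0, j}) → f - 1 ∈ negPart A 0 →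
      f ∈ TS A {0} := fun f hf hf1 => by
    classical
    rw [mem_TS]
    intro p hp l hl
    have hl0 : 0 ≠ l := fun h => hl h.symm
    by_cases h : ∃ j, 0 ≠ j ∧ j ≠ l
    · obtain ⟨j, hj, hjl⟩ := h
      exact mem_TS.1 (hf j hj) p hp l (by simp [hl0.symm, hjl.symm])
    · push Not at h
      have hsum : p.1 0 + p.1 l = 0 := by
        rw [← sum_eq_zero p]
        exact (Fintype.sum_eq_add 0 l hl0 fun m hm => absurd (h m hm.1.symm) hm.2).symm
      by_cases hp0 : p = 0
      · rw [hp0]; exact le_rfl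
      · have : p.1 0 < 0 := mem_negPart.1 hf1 p (by
          rwa [AddMonoidAlgebra.coeff_sub, Finsupp.sub_apply, AddMonoidAlgebra.one_def,
            AddMonoidAlgebra.coeff_single, Finsupp.single_apply, if_neg (Ne.symm hp0), sub_zero])
        omega
  have hbm : b j₀ hj₀ ∈ TS A {0} :=
    hmem _ (fun j hj => by rw [(huniq j hj).2]; exact hb j hj) (hb1 _ _)
  have hbm' : b' j₀ hj₀ ∈ TS A {0} :=
    hmem _ (fun j hj => by rw [huniq' j hj]; exact hb' j hj) (hb1' _ _)
  let s₀ : (T₁ A (0 : Fin (n + 1)))ˣ :=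
    ⟨⟨_, hbm'⟩, ⟨_, hbm⟩, Subtype.ext ((mul_comm _ _).trans (hbb j₀ hj₀)),
      Subtype.ext (hbb j₀ hj₀)⟩
  let s : ∀ j : Fin (n + 1), (T₁ A j)ˣ := fun j =>
    if hj : 0 = j then hj ▸ s₀ else
      ⟨⟨_, ha j hj⟩, ⟨_, ha' j hj⟩, Subtype.ext (haa j hj),
        Subtype.ext ((mul_comm _ _).trans (haa j hj))⟩
  have hs0 : s 0 = s₀ := dif_pos rfl
  refine ⟨d j₀ hj₀, s, fun j => ?_⟩
  by_cases hj : 0 = j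
  · subst hj
    have h0 : (s 0 : T₁ A 0).1 * ((s 0)⁻¹ : (T₁ A 0)ˣ).1.1 = 1 :=
      congrArg Subtype.val (s 0).mul_inv
    have hr : ratioExp (0 : Fin (n + 1)) 0 = 0 := by apply Subtype.ext; simp [ratioExp]
    rw [hself, mul_assoc, h0, mul_one, hr, smul_zero]
    rfl
  · have hsj : (s j : T₁ A j).1 = a j hj := by simp only [s, dif_neg hj]
    have hs0' : ((s 0)⁻¹ : (T₁ A 0)ˣ).1.1 = b j₀ hj₀ := by rw [hs0]; rfl
    rw [hsj, hs0', (huniq j hj).1, (huniq j hj).2]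
    exact hfac j hj

end Units

/-! ### Freeness over the charts -/

/-- An invertible module whose base change along a surjection is trivial has a section and a dual
section that pair to `1` after this base change. -/
theorem exists_algebraMap_dual_apply_eq_one {R A M : Type*} [CommRing R] [CommRing A] [Algebra R A]
    [AddCommGroup M] [Module R M] [Module.Invertible R M] [Subsingleton (CommRing.Pic A)]
    (hsurj : Function.Surjective (algebraMap R A)) :
    ∃ (z : M) (z' : Module.Dual R M), algebraMap R A (z' z) = 1 := by
  obtain ⟨e⟩ := Module.Invertible.free_iff_linearEquiv.1
    (inferInstance : Module.Free A (A ⊗[R] M))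
  obtain ⟨z, hz⟩ := TensorProduct.mk_surjective R M A hsurj (e.symm 1)
  obtain ⟨z', hz'⟩ := Module.projective_lifting_property (Algebra.linearMap R A)
    ((e.toLinearMap.restrictScalars R).comp (TensorProduct.mk R A M 1)) hsurj
  refine ⟨z, z', ?_⟩
  have := congrArg (fun f => f z) hz'
  simp only [LinearMap.comp_apply] at this
  refine this.trans ?_
  rw [hz]
  exact e.apply_symm_apply 1

section BaseChangeFrames

variable {R S N E : Type*} [CommRing R] [CommRing S] [Algebra R S] [AddCommGroup N] [Module R N]
  [AddCommGroup E] [Module S E]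

theorem baseChange_one_tmul (h : Module.Dual R N) (v : N) :
    h.baseChange S (1 ⊗ₜ v) = algebraMap R S (h v) := by
  rw [Module.Dual.baseChange_apply_tmul, Algebra.algebraMap_eq_smul_one]

/-- Generators of an invertible module and of its dual remain such after base change. -/
theorem exists_baseChange_generators [Module.Invertible R N] (t : E ≃ₗ[S] S ⊗[R] N) :
    ∃ (m : ℕ) (f : Fin m → Module.Dual R N) (x : Fin m → N) (g : Fin m → Module.Dual S E)
      (y : Fin m → E), (∀ a b, g a (y b) = algebraMap R S (f a (x b))) ∧ ∑ a, g a (y a) = 1 ∧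
        (∀ (z : N) a, g a (t.symm (1 ⊗ₜ z)) = algebraMap R S (f a z)) ∧
        ∀ (z' : Module.Dual R N) a,
          (z'.baseChange S ∘ₗ t.toLinearMap) (y a) = algebraMap R S (z' (x a)) := by
  obtain ⟨m, f, x, hfx⟩ := exists_sum_dual_eq_one R N
  have h : ∀ (z' : Module.Dual R N) (z : N),
      (z'.baseChange S ∘ₗ t.toLinearMap) (t.symm (1 ⊗ₜ z)) = algebraMap R S (z' z) :=
    fun z' z => by
      rw [LinearMap.comp_apply, LinearEquiv.coe_coe, t.apply_symm_apply, baseChange_one_tmul]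
  refine ⟨m, f, x, fun a => (f a).baseChange S ∘ₗ t.toLinearMap, fun a => t.symm (1 ⊗ₜ x a),
    fun a b => h _ _, ?_, fun z a => h _ _, fun z' a => h _ _⟩
  rw [Finset.sum_congr rfl fun a _ => h (f a) (x a), ← map_sum, hfx, map_one]

/-- If `E` is the base change of an invertible module `N`, generated by `y` and with dual generated
by `g`, then `N` is free as soon as `E` has a generator `s` which, together with its inverse `s'`
and up to a unit `v`, is defined over the smaller ring. -/
theorem nonempty_linearEquiv_of_generator [Module.Invertible R N] [Module.Invertible S E] {m : ℕ}
    {f : Fin m → Module.Dual R N} {x : Fin m → N} {g : Fin m → Module.Dual S E} {y : Fin m → E}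
    (hinj : Function.Injective (algebraMap R S))
    (hgy : ∀ a b, g a (y b) = algebraMap R S (f a (x b))) (hsum : ∑ a, g a (y a) = 1)
    {s : E} {s' : Module.Dual S E} (hss : s' s = 1) {v v' : S} (hv : v * v' = 1)
    {r q : Fin m → R} (hr : ∀ c, algebraMap R S (r c) = v * g c s)
    (hq : ∀ c, algebraMap R S (q c) = v' * s' (y c)) : Nonempty (N ≃ₗ[R] R) := by
  have hs : ∑ b, g b s • y b = s := by
    rw [Finset.sum_congr rfl fun b _ => dual_exchange (g b) s (y b), ← Finset.sum_smul, hsum,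
      one_smul]
  refine ⟨equivOfDualApplyEqOne (∑ c, q c • f c) (∑ b, r b • x b) (hinj ?_)⟩
  have h1 : ∀ c, ∑ b, g b s * g c (y b) = g c s := fun c => by
    conv_rhs => rw [← hs, map_sum]
    simp only [map_smul, smul_eq_mul]
  calc algebraMap R S ((∑ c, q c • f c) (∑ b, r b • x b))
      = ∑ c, s' (y c) * ∑ b, g b s * g c (y b) := by
        simp only [LinearMap.sum_apply, LinearMap.smul_apply, map_sum, map_smul, smul_eq_mul,
          map_mul, hr, hq, ← hgy, Finset.mul_sum]
        rw [Finset.sum_comm]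
        exact Finset.sum_congr rfl fun c _ => Finset.sum_congr rfl fun b _ => by
          linear_combination (s' (y c) * g b s * g c (y b)) * hv
    _ = s' (∑ c, g c s • y c) := by
        rw [map_sum]
        exact Finset.sum_congr rfl fun c _ => by rw [h1, map_smul, smul_eq_mul, mul_comm]
    _ = algebraMap R S 1 := by rw [hs, hss, map_one]

/-- Two invertible modules over different rings with isomorphic base changes give rise to an
invertible module `E` over the larger ring with two systems of generators of itself and its dual;
a generator of `E` that is defined over one of the smaller rings trivialises the module over it. -/
theorem exists_glued_frames.{u₁, u₂, u₃, v₁, v₂} {R : Type u₁} {R' : Type u₂} {S : Type u₃}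
    {M : Type v₁} {N : Type v₂} [CommRing R] [CommRing R'] [CommRing S]
    [Algebra R S] [Algebra R' S] [AddCommGroup M] [Module R M] [Module.Invertible R M]
    [AddCommGroup N] [Module R' N] [Module.Invertible R' N]
    (hinj : Function.Injective (algebraMap R' S)) (t : S ⊗[R] M ≃ₗ[S] S ⊗[R'] N) (z : M)
    (z' : Module.Dual R M) :
    ∃ (E : Type (max v₁ u₃)) (_ : AddCommGroup E) (_ : Module S E) (_ : Module.Invertible S E)
      (m m' : ℕ) (x : Fin m → E) (f : Fin m → Module.Dual S E) (y : Fin m' → E)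
      (g : Fin m' → Module.Dual S E) (z₁ : E) (z₁' : Module.Dual S E),
      (∀ a c, f c (x a) ∈ Set.range (algebraMap R S)) ∧ ∑ a, f a (x a) = 1 ∧
      (∀ a c, g c (y a) ∈ Set.range (algebraMap R' S)) ∧ ∑ a, g a (y a) = 1 ∧
      (∀ c, f c z₁ ∈ Set.range (algebraMap R S)) ∧
      (∀ a, z₁' (x a) ∈ Set.range (algebraMap R S)) ∧ z₁' z₁ = algebraMap R S (z' z) ∧
      ∀ (s : E) (s' : Module.Dual S E) (v v' : S), s' s = 1 → v * v' = 1 →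
        (∀ c, v * g c s ∈ Set.range (algebraMap R' S)) →
        (∀ a, v' * s' (y a) ∈ Set.range (algebraMap R' S)) → Nonempty (N ≃ₗ[R'] R') := by
  obtain ⟨m, f, x, f₁, x₁, hfx, hsum, hfz, hz'x⟩ :=
    exists_baseChange_generators (LinearEquiv.refl S (S ⊗[R] M))
  obtain ⟨m', g, y, g₁, y₁, hgy, hsum', -, -⟩ := exists_baseChange_generators t
  refine ⟨S ⊗[R] M, inferInstance, inferInstance, inferInstance, m, m', x₁, f₁, y₁, g₁, 1 ⊗ₜ z,
    z'.baseChange S, fun a c => ⟨_, (hfx c a).symm⟩, hsum, fun a c => ⟨_, (hgy c a).symm⟩, hsum',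
    fun c => ⟨_, (hfz z c).symm⟩, fun a => ⟨_, (hz'x z' a).symm⟩, baseChange_one_tmul z' z, ?_⟩
  intro s s' v v' hss hv hr hq
  choose r hr using hr
  choose q hq using hq
  exact nonempty_linearEquiv_of_generator hinj hgy hsum' hss hv hr hq

end BaseChangeFrames

section

variable {A : Type*} [CommRing A] {n : ℕ}

theorem evalPoint_surjective (i : Fin (n + 1)) : Function.Surjective (evalPoint A i) := fun a => by
  refine ⟨algebraMap A (T₁ A i) a, ?_⟩
  rw [evalPoint_apply]
  exact Finsupp.single_eq_same

/-- Every invertible module on a chart has a section and a dual section that pair to a function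
with constant term `1`. -/
theorem exists_coeff_zero_dual_apply_eq_one [Subsingleton (CommRing.Pic A)] (i : Fin (n + 1))
    (M : Type*) [AddCommGroup M] [Module (T₁ A i) M] [Module.Invertible (T₁ A i) M] :
    ∃ (z : M) (z' : Module.Dual (T₁ A i) M), (z' z).1.coeff 0 = 1 := by
  let : Algebra (T₁ A i) A := (evalPoint A i).toAlgebra
  obtain ⟨z, z', h⟩ := exists_algebraMap_dual_apply_eq_one (R := T₁ A i) (A := A) (M := M)
    (evalPoint_surjective i)
  exact ⟨z, z', by rw [← evalPoint_apply]; exact h⟩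

/-- An invertible sheaf on the union of the charts `i` and `j` is trivial on the chart `j`: on the
projective line with coordinate `X_j / X_i` obtained by blowing up the point of the chart `i` where
all other coordinates vanish, it is a twist `𝒪(-d)`. -/
theorem nonempty_linearEquiv_of_glued (hconn : ∀ e : A, e * (1 - e) = 0 → e = 0 ∨ e = 1)
    [Subsingleton (CommRing.Pic A)] {i j : Fin (n + 1)} (hij : i ≠ j)
    (M N : Type*) [AddCommGroup M] [Module (T₁ A i) M] [Module.Invertible (T₁ A i) M]
    [AddCommGroup N] [Module (T₁ A j) N] [Module.Invertible (T₁ A j) N]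
    (t : T₂ A i j ⊗[T₁ A i] M ≃ₗ[T₂ A i j] T₂ A i j ⊗[T₁ A j] N) :
    Nonempty (N ≃ₗ[T₁ A j] T₁ A j) := by
  obtain ⟨z, z', hz⟩ := exists_coeff_zero_dual_apply_eq_one (A := A) i M
  have hinj : Function.Injective (algebraMap (T₁ A j) (T₂ A i j)) := fun u v h =>
    Subtype.ext (congrArg (fun w : T₂ A i j => w.1) h)
  obtain ⟨E, _, _, _, m, m', x, f, y, g, z₁, z₁', hx, hx1, hy, hy1, hz₁, hz₁', hzz, H⟩ :=
    exists_glued_frames hinj t z z'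
  have hi : ∀ {w : T₂ A i j}, w ∈ Set.range (algebraMap (T₁ A i) (T₂ A i j)) → w.1 ∈ TS A {i} := by
    rintro _ ⟨r, rfl⟩
    exact r.2
  have hj : ∀ {w : T₂ A i j}, w ∈ Set.range (algebraMap (T₁ A j) (T₂ A i j)) → w.1 ∈ TS A {j} := by
    rintro _ ⟨r, rfl⟩
    exact r.2
  obtain ⟨d, s, s', hss, -, -, hr, hq, -⟩ := exists_trivialization hconn hij x f y g z₁ z₁'
    (fun a c => hi (hx a c)) hx1 (fun a c => hj (hy a c)) hy1 (fun c => hi (hz₁ c))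
    (fun a => hi (hz₁' a)) (hi ⟨_, hzz.symm⟩) (by rw [hzz]; exact hz)
  exact H s s' _ _ hss
    (by rw [← Units.val_mul, ← zpow_add, add_neg_cancel, zpow_zero, Units.val_one])
    (fun c => ⟨⟨_, hr c⟩, rfl⟩) (fun a => ⟨⟨_, hq a⟩, rfl⟩)

theorem nonempty_linearEquiv_of_subsingleton [Subsingleton (CommRing.Pic A)]
    [Subsingleton (Fin (n + 1))] (j : Fin (n + 1)) (N : Type*) [AddCommGroup N] [Module (T₁ A j) N]
    [Module.Invertible (T₁ A j) N] : Nonempty (N ≃ₗ[T₁ A j] T₁ A j) := by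
  obtain ⟨z, z', hz⟩ := exists_coeff_zero_dual_apply_eq_one (A := A) j N
  refine ⟨equivOfDualApplyEqOne z' z (Subtype.ext (AddMonoidAlgebra.ext (Finsupp.ext fun p => ?_)))⟩
  have hp : p = 0 := by
    ext l
    exact (Fintype.sum_subsingleton _ l).symm.trans (sum_eq_zero p)
  rw [hp, hz]
  exact Finsupp.single_eq_same.symm

end

/-! ### Transition functions -/

section BaseChange

variable {R R' S U M N : Type*} [CommRing R] [CommRing R'] [CommRing S] [CommRing U]
  [Algebra R S] [Algebra R' S] [Algebra S U] [Algebra R U] [Algebra R' U]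
  [IsScalarTower R S U] [IsScalarTower R' S U]
  [AddCommGroup M] [Module R M] [AddCommGroup N] [Module R' N]

theorem baseChangeTriv_tmul (ψ : M ≃ₗ[R] R) (c : S) (m : M) :
    baseChangeTriv S ψ (c ⊗ₜ m) = c * algebraMap R S (ψ m) := by
  change ψ m • c = _
  rw [Algebra.smul_def, mul_comm]

theorem baseChangeTriv_cancelBaseChange (ψ : N ≃ₗ[R'] R') (c : U) (y : S ⊗[R'] N) :
    baseChangeTriv U ψ (TensorProduct.AlgebraTensorModule.cancelBaseChange R' S U U N (c ⊗ₜ y)) =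
      c * algebraMap S U (baseChangeTriv S ψ y) := by
  induction y with
  | zero => simp
  | add y y' hy hy' => simp only [TensorProduct.tmul_add, map_add, hy, hy', mul_add]
  | tmul b m =>
    rw [TensorProduct.AlgebraTensorModule.cancelBaseChange_tmul, baseChangeTriv_tmul,
      baseChangeTriv_tmul, map_mul, ← IsScalarTower.algebraMap_apply, Algebra.smul_def]
    ring

/-- An isomorphism between trivialised modules is multiplication by a function. -/
theorem exists_transition_function (e : S ⊗[R] M ≃ₗ[S] S ⊗[R'] N) (ψ : M ≃ₗ[R] R)
    (ψ' : N ≃ₗ[R'] R') :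
    ∃ u : S, ∀ x, baseChangeTriv S ψ' (e x) = baseChangeTriv S ψ x * u := by
  refine ⟨baseChangeTriv S ψ' (e ((baseChangeTriv S ψ).symm 1)), fun x => ?_⟩
  have hx : x = baseChangeTriv S ψ x • (baseChangeTriv S ψ).symm 1 := by
    rw [← map_smul, smul_eq_mul, mul_one, LinearEquiv.symm_apply_apply]
  conv_lhs => rw [hx, map_smul, map_smul, smul_eq_mul]

theorem eq_one_of_forall_baseChangeTriv {ψ : M ≃ₗ[R] R} {u : S}
    (h : ∀ x, baseChangeTriv S ψ x = baseChangeTriv S ψ x * u) : u = 1 := by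
  have := h ((baseChangeTriv S ψ).symm 1)
  rwa [LinearEquiv.apply_symm_apply, one_mul, eq_comm] at this

/-- Base change of isomorphisms corresponds to base change of transition functions. -/
theorem baseChangeTriv_restrictOverlap {e : S ⊗[R] M ≃ₗ[S] S ⊗[R'] N} {ψ : M ≃ₗ[R] R}
    {ψ' : N ≃ₗ[R'] R'} {u : S}
    (h : ∀ x, baseChangeTriv S ψ' (e x) = baseChangeTriv S ψ x * u) (x : U ⊗[R] M) :
    baseChangeTriv U ψ' (restrictOverlap U e x) = baseChangeTriv U ψ x * algebraMap S U u := by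
  induction x with
  | zero => simp
  | add x x' hx hx' => simp only [map_add, hx, hx', add_mul]
  | tmul c m =>
    have h1 : restrictOverlap U e (c ⊗ₜ m) =
        TensorProduct.AlgebraTensorModule.cancelBaseChange R' S U U N (c ⊗ₜ e (1 ⊗ₜ m)) := rfl
    rw [h1, baseChangeTriv_cancelBaseChange, h, baseChangeTriv_tmul, baseChangeTriv_tmul, one_mul,
      map_mul, ← IsScalarTower.algebraMap_apply, mul_assoc]

end BaseChange

end ProjCover

set_option maxHeartbeats 1600000 in
theorem mainTheorem8 (A : Type*) [CommRing A]
    (hconn : ∀ e : A, e * (1 - e) = 0 → e = 0 ∨ e = 1)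
    (hPic : Subsingleton (CommRing.Pic A))
    (n : ℕ)
    (M : Fin (n + 1) → Type*) [∀ i, AddCommGroup (M i)]
    [∀ i, Module (ProjCover.T₁ A i) (M i)]
    (hM : ∀ i, ProjCover.IsProjRankOne (ProjCover.T₁ A i) (M i))
    (t : ∀ i j : Fin (n + 1),
      (ProjCover.T₂ A i j) ⊗[ProjCover.T₁ A i] (M i) ≃ₗ[ProjCover.T₂ A i j]
        (ProjCover.T₂ A i j) ⊗[ProjCover.T₁ A j] (M j))
    (ht_self : ∀ (i : Fin (n + 1)) (x : (ProjCover.T₂ A i i) ⊗[ProjCover.T₁ A i] (M i)),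
      t i i x = x)
    (ht_cocycle : ∀ (i j k : Fin (n + 1))
      (x : (ProjCover.T₃ A i j k) ⊗[ProjCover.T₁ A i] (M i)),
      ProjCover.restrictOverlap (ProjCover.T₃ A i j k) (t i k) x =
        ProjCover.restrictOverlap (ProjCover.T₃ A i j k) (t j k)
          (ProjCover.restrictOverlap (ProjCover.T₃ A i j k) (t i j) x)) :
    ∃ (d : ℤ) (s : ∀ i : Fin (n + 1), (ProjCover.T₁ A i)ˣ)
      (ψ : ∀ i : Fin (n + 1), M i ≃ₗ[ProjCover.T₁ A i] ProjCover.T₁ A i),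
      ∀ (i j : Fin (n + 1)) (x : (ProjCover.T₂ A i j) ⊗[ProjCover.T₁ A i] (M i)),
        ProjCover.baseChangeTriv (ProjCover.T₂ A i j) (ψ j) (t i j x) =
          ProjCover.baseChangeTriv (ProjCover.T₂ A i j) (ψ i) x *
            ((ProjCover.ratio A i j ^ d : (ProjCover.T₂ A i j)ˣ) : ProjCover.T₂ A i j) *
            algebraMap (ProjCover.T₁ A j) (ProjCover.T₂ A i j) (s j : ProjCover.T₁ A j) *
            algebraMap (ProjCover.T₁ A i) (ProjCover.T₂ A i j)
              ((s i)⁻¹ : (ProjCover.T₁ A i)ˣ) := by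
  open ProjCover in
  have hinv : ∀ i, Module.Invertible (T₁ A i) (M i) := fun i => (hM i).invertible
  have hfree : ∀ j, Nonempty (M j ≃ₗ[T₁ A j] T₁ A j) := fun j => by
    by_cases h : ∃ i, i ≠ j
    · obtain ⟨i, hij⟩ := h
      exact nonempty_linearEquiv_of_glued hconn hij (M i) (M j) (t i j)
    · push Not at h
      have : Subsingleton (Fin (n + 1)) := ⟨fun a b => (h a).trans (h b).symm⟩
      exact nonempty_linearEquiv_of_subsingleton j (M j)
  let ψ : ∀ j, M j ≃ₗ[T₁ A j] T₁ A j := fun j => (hfree j).some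
  choose u hu using fun i j => exists_transition_function (t i j) (ψ i) (ψ j)
  have hself : ∀ i, u i i = 1 := fun i => eq_one_of_forall_baseChangeTriv fun x => by
    conv_lhs => rw [← ht_self i x]
    exact hu i i x
  have hcoc : ∀ i j k, (u i j).1 * (u j k).1 = (u i k).1 := fun i j k => by
    obtain ⟨x, hx⟩ := (baseChangeTriv (T₃ A i j k) (ψ i)).surjective 1
    have h := congrArg (baseChangeTriv (T₃ A i j k) (ψ k)) (ht_cocycle i j k x)
    rw [baseChangeTriv_restrictOverlap (hu i k), baseChangeTriv_restrictOverlap (hu j k),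
      baseChangeTriv_restrictOverlap (hu i j), hx, one_mul, one_mul] at h
    exact (congrArg Subtype.val h).symm
  obtain ⟨d, s, hs⟩ := cocycle_eq hconn (fun i j => (u i j).1) (fun i j => (u i j).2)
    (fun i => congrArg Subtype.val (hself i)) hcoc
  refine ⟨d, s, ψ, fun i j x => ?_⟩
  have huij : u i j = ((ratio A i j ^ d : (T₂ A i j)ˣ) : T₂ A i j) *
      algebraMap (T₁ A j) (T₂ A i j) (s j : T₁ A j) *
      algebraMap (T₁ A i) (T₂ A i j) ((s i)⁻¹ : (T₁ A i)ˣ) := by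
    refine Subtype.ext ((hs i j).trans ?_)
    rw [monom, ← coe_ratio_zpow]
    rfl
  rw [hu, huij, mul_assoc, mul_assoc, mul_assoc]
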